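/- Let $\kappa,\sigma,\sigma_n>0$, $\theta\in\mathbb R$, and let $\{X_t\}_{t\ge 0}$ be the stationary Ornstein–Uhlenbeck process $dX_t=\kappa(\theta-X_t)\,dt+\sigma\,dW_t$, where $W$ is a standard Brownian motion and $X_0\sim\mathcal N(\theta,\sigma^2/(2\kappa))$ is independent of $W$. The process is sampled uniformly, at times $t_i=i\,\Delta t$ with $\Delta t>0$, and the $i$th sample is received at a time $t_i'>t_i$ as the observation $Y_{t_i'}=X_{t_i}+N_{t_i'}$, where the noise values $N_{t_i'}$ are i.i.d. $\mathcal N(0,\sigma_n^2)$ and independent of $\{X_t\}$. For $1\le m\le n$ and $t>t_n'$ let the value of information be the mutual information (in nats) $$v(t)=I\big(X_t;\,Y_{t_n'},\dots,Y_{t_{n-m+1}'}\big),$$ and put $\rho=e^{-\kappa\Delta t}$ and $\gamma=\dfrac{\sigma^2}{2\kappa\sigma_n^2}$ (the signal-to-noise ratio). Then, for fixed $\kappa,\Delta t,m,n,t$, in the low-SNR regime $\gamma\to 0$, $$v(t)=-\frac12\log\left[1-\frac{e^{-2\kappa(t-t_n)}(1-\rho^{2m})}{1-\rho^2}\,\gamma+e^{-2\kappa(t-t_n)}\left(\frac{(1-\rho^{2m})(1+\rho^2)}{(1-\rho^2)^2}-\frac{2m\rho^{2m}}{1-\rho^2}\right)\gamma^2\right]+O(\gamma^3);$$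 in particular $v(t)$ is finite, and the constant in $O(\gamma^3)$ and the range of $\gamma$ do not depend on $\theta$, nor on $\sigma$ and $\sigma_n$ other than through $\gamma$. The expansion depends genuinely on $m$: for two different window lengths $m\ne m'$ ($m,m'\ge1$), with the other parameters fixed, the difference of the two logarithmic expressions is not $O(\gamma^3)$ as $\gamma\to0^+$. -/

import Mathlib

open MeasureTheory ProbabilityTheory
open scoped NNReal ENNReal

/-- Mutual information `I(U; V)` (in nats) of two random variables: the Kullback-Leibler divergence
of the joint law from the product of the marginal laws. -/
noncomputable def mutualInfo {Ω α β : Type*} [MeasurableSpace Ω] [MeasurableSpace α]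
    [MeasurableSpace β] (U : Ω → α) (V : Ω → β) (P : Measure Ω) : ℝ≥0∞ :=
  InformationTheory.klDiv (P.map (fun ω => (U ω, V ω))) ((P.map U).prod (P.map V))

/-- Value of information at time `t` for the observations `Y 1, Y 2, …`, of which `Y n` is the most
recent one: the mutual information between the current status `X t` and the window
`Y n, Y (n - 1), …, Y (n - m + 1)` of the `m` most recent observations. -/
noncomputable def valueOfInformation {Ω : Type*} [MeasurableSpace Ω] (X : ℝ≥0 → Ω → ℝ)
    (Y : ℕ → Ω → ℝ) (m n : ℕ) (t : ℝ≥0) (P : Measure Ω) : ℝ≥0∞ :=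
  mutualInfo (X t) (fun ω (k : Fin m) => Y (n - (k : ℕ)) ω) P

/-- `X` is the stationary Ornstein-Uhlenbeck process driven by the Brownian motion `W`, that is, the
continuous solution of `dX_t = κ (θ - X_t) dt + σ dW_t` whose initial value is independent of `W`
and has law `N(θ, σ² / (2κ))`. As the noise is additive, the equation is the pathwise
integral equation `X_t = X_0 + ∫₀ᵗ κ (θ - X_s) ds + σ W_t`. -/
structure IsStationaryOU {Ω : Type*} [MeasurableSpace Ω] (κ θ σ : ℝ) (X W : ℝ≥0 → Ω → ℝ)
    (P : Measure Ω) : Prop where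
  brownian : IsBrownianReal W P
  measurable : ∀ t, Measurable (X t)
  law_init : P.map (X 0) = gaussianReal θ (σ ^ 2 / (2 * κ)).toNNReal
  indep_init : IndepFun (X 0) (fun ω s => W s ω) P
  continuous_paths : ∀ᵐ ω ∂P, Continuous (fun t => X t ω)
  sde : ∀ᵐ ω ∂P, ∀ t : ℝ≥0,
    X t ω = X 0 ω + (∫ s in (0 : ℝ)..(t : ℝ), κ * (θ - X s.toNNReal ω)) + σ * W t ω

/-- Additive observation noise: `N i` is the noise in the `i`-th observation; the `N i` are i.i.d.
with law `N(0, σn²)` and jointly independent of the process `X`. -/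
structure IsGaussianNoise {Ω : Type*} [MeasurableSpace Ω] (σn : ℝ) (X : ℝ≥0 → Ω → ℝ)
    (N : ℕ → Ω → ℝ) (P : Measure Ω) : Prop where
  measurable : ∀ i, Measurable (N i)
  law : ∀ i, P.map (N i) = gaussianReal 0 (σn ^ 2).toNNReal
  indep : iIndepFun N P
  indep_process : IndepFun (fun ω s => X s ω) (fun ω i => N i ω) P

/-- Uniform sampling: the `i`-th status update is generated at time `i Δt`. -/
noncomputable def sampleTime (Δt : ℝ≥0) (i : ℕ) : ℝ≥0 := i * Δt

/-- The `i`-th observation: the `i`-th sample of `X` plus the `i`-th noise value. -/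
noncomputable def observation {Ω : Type*} (Δt : ℝ≥0) (X : ℝ≥0 → Ω → ℝ) (N : ℕ → Ω → ℝ)
    (i : ℕ) (ω : Ω) : ℝ :=
  X (sampleTime Δt i) ω + N i ω

/-- The signal-to-noise ratio `γ`: the stationary variance `σ² / (2κ)` of the Ornstein-Uhlenbeck
process divided by the noise variance `σn²`. -/
noncomputable def snr (κ σ σn : ℝ) : ℝ := σ ^ 2 / (2 * κ * σn ^ 2)

/-- The low-SNR expansion, without error term, for window length `m`, one-step correlation `ρ` and
age `a = t - t_n` of the most recent sample, as a function of the signal-to-noise ratio `γ`. -/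
noncomputable def lowSnrExpansion (κ a ρ : ℝ) (m : ℕ) (γ : ℝ) : ℝ :=
  -(1 / 2) * Real.log
    (1 - Real.exp (-2 * κ * a) * (1 - ρ ^ (2 * m)) / (1 - ρ ^ 2) * γ
      + Real.exp (-2 * κ * a)
        * ((1 - ρ ^ (2 * m)) * (1 + ρ ^ 2) / (1 - ρ ^ 2) ^ 2
            - 2 * m * ρ ^ (2 * m) / (1 - ρ ^ 2)) * γ ^ 2)

/-! The pair (X_t, Y) is jointly Gaussian. Let s = σ²/(2κ), a = e^{-2κ(t-t_n)}, r_i = ρ^i and R_ij =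
ρ^|i-j|. Regressing X_t on the observations gives X_t = E + g(Y) with g affine and E Gaussian,
uncorrelated with Y and hence independent of it. For such a decomposition the mutual information is
½ log(Var X_t / Var E) (`mutualInfo_add_of_indepFun`). If x solves the normal equations (1 + γR)x =
r, then Var E = s(1 - aγ r·x), so v(t) = -½ log(1 - aγ r·x) (`valueOfInformation_eq_log`).

For small γ, r·x = r·r - γ r·Rr + O(γ²) (`abs_dotProduct_sub_le`). Since i + |i-j| + j = 2 max(i,j),
both coefficients are sums of powers of ρ² with the stated closed forms, and the logarithm is
Lipschitz away from 0. Only γ, κ, Δt, m and the age t - t_n enter, which gives the uniformity. The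
windows are told apart by the first-order coefficient, which is injective in m.

The law of X must be derived from the integral equation (`IsStationaryOU.hasGaussianLaw`). Variation
of constants, with the noise integrated by parts, expresses X_t pathwise through X_0 and a Lebesgue
integral of W, so no stochastic integral is needed. Riemann sums of that integral are Gaussian,
their covariances are L² inner products of step kernels, and both properties pass to the limit
(`HasGaussianLaw.of_tendsto_covariance`). -/

/-! ### Mutual information of an additive Gaussian channel. -/

lemma lintegral_gaussianReal {μ : ℝ} {v : ℝ≥0} (hv : v ≠ 0) {f : ℝ → ℝ≥0∞} (hf : Measurable f) :
    ∫⁻ x, f x ∂(gaussianReal μ v) = ∫⁻ x, gaussianPDF μ v x * f x := by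
  rw [gaussianReal_of_var_ne_zero μ hv,
    lintegral_withDensity_eq_lintegral_mul _ (measurable_gaussianPDF μ v) hf]
  rfl

section GaussianChannel

variable {Ω β : Type*} [MeasurableSpace Ω] [MeasurableSpace β] {P : Measure Ω}
  [IsProbabilityMeasure P] {E : Ω → ℝ} {V : Ω → β} {g : β → ℝ} {μ₁ μ₂ : ℝ} {v₁ v₂ : ℝ≥0}

/-- Joint law of `(E + g V, V)` for a Gaussian variable `E` independent of `V`: its density with
respect to the product of the marginal laws is a quotient of Gaussian densities. -/
lemma map_add_prodMk_eq_withDensity (hE : Measurable E) (hV : Measurable V) (hg : Measurable g)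
    (hv₁ : v₁ ≠ 0) (hv₂ : v₂ ≠ 0) (hind : IndepFun E V P) (hlE : P.map E = gaussianReal μ₁ v₁)
    (hlU : P.map (fun ω => E ω + g (V ω)) = gaussianReal μ₂ v₂) :
    P.map (fun ω => (E ω + g (V ω), V ω)) =
      ((P.map (fun ω => E ω + g (V ω))).prod (P.map V)).withDensity
        (fun z => gaussianPDF μ₁ v₁ (z.1 - g z.2) / gaussianPDF μ₂ v₂ z.1) := by
  have : IsProbabilityMeasure (P.map V) := Measure.isProbabilityMeasure_map hV.aemeasurable
  have hp₁ := measurable_gaussianPDF μ₁ v₁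
  have hp₂ := measurable_gaussianPDF μ₂ v₂
  refine Measure.ext_of_lintegral _ fun f hf => ?_
  have hr : Measurable fun z : ℝ × β =>
      gaussianPDF μ₁ v₁ (z.1 - g z.2) / gaussianPDF μ₂ v₂ z.1 := by fun_prop
  rw [lintegral_withDensity_eq_lintegral_mul _ hr hf, lintegral_map hf (by fun_prop),
    ← lintegral_map (μ := P) (f := fun z : ℝ × β => f (z.1 + g z.2, z.2))
      (g := fun ω => (E ω, V ω)) (by fun_prop) (by fun_prop),
    (indepFun_iff_map_prod_eq_prod_map_map hE.aemeasurable hV.aemeasurable).1 hind,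
    -- The value y of V is frozen in the outer integral, so that adding g y is a mere translation of
    -- the inner variable.
    lintegral_prod_symm _ (by fun_prop), lintegral_prod_symm _ (by fun_prop), hlE, hlU]
  refine lintegral_congr fun y => ?_
  rw [lintegral_gaussianReal hv₁ (by fun_prop), lintegral_gaussianReal hv₂ (by fun_prop),
    ← lintegral_sub_right_eq_self _ (g y)]
  refine lintegral_congr fun x => ?_
  simp only [Pi.mul_apply, sub_add_cancel]
  rw [← mul_assoc, ENNReal.mul_div_cancel (gaussianPDF_pos μ₂ hv₂ x).ne' gaussianPDF_ne_top]

lemma log_gaussianPDFReal (μ : ℝ) {v : ℝ≥0} (hv : v ≠ 0) (x : ℝ) :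
    Real.log (gaussianPDFReal μ v x) =
      -(1 / 2) * Real.log (2 * Real.pi * v) - (x - μ) ^ 2 / (2 * v) := by
  have : (0 : ℝ) < v := by positivity
  rw [gaussianPDFReal, Real.log_mul (by positivity) (by positivity), Real.log_exp, Real.log_inv,
    Real.log_sqrt (by positivity)]
  ring

lemma integral_sub_sq_of_map_eq_gaussianReal {U : Ω → ℝ} {μ : ℝ} {v : ℝ≥0} (hU : Measurable U)
    (h : P.map U = gaussianReal μ v) :
    Integrable (fun ω => (U ω - μ) ^ 2) P ∧ ∫ ω, (U ω - μ) ^ 2 ∂P = v := by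
  have hlaw : HasLaw U (gaussianReal μ v) P := ⟨hU.aemeasurable, h⟩
  have hm : ∫ ω, U ω ∂P = μ := by rw [hlaw.integral_eq, integral_id_gaussianReal]
  constructor
  · exact (hlaw.hasGaussianLaw.memLp_two.sub (memLp_const μ)).integrable_sq
  · have := hlaw.variance_eq
    rw [variance_id_gaussianReal, variance_eq_integral hU.aemeasurable, hm] at this
    exact this

/-- Mutual information of `U = E + g V` and `V` when `E` is Gaussian and independent of `V`, and
`U` is Gaussian. -/
theorem mutualInfo_add_of_indepFun (hE : Measurable E) (hV : Measurable V) (hg : Measurable g)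
    (hv₁ : v₁ ≠ 0) (hv₂ : v₂ ≠ 0) (hind : IndepFun E V P) (hlE : P.map E = gaussianReal μ₁ v₁)
    (hlU : P.map (fun ω => E ω + g (V ω)) = gaussianReal μ₂ v₂) :
    mutualInfo (fun ω => E ω + g (V ω)) V P ≠ ∞ ∧
      (mutualInfo (fun ω => E ω + g (V ω)) V P).toReal = 1 / 2 * Real.log (v₂ / v₁) := by
  have hU : Measurable fun ω => E ω + g (V ω) := by fun_prop
  have : IsProbabilityMeasure (P.map V) := Measure.isProbabilityMeasure_map hV.aemeasurable
  have : IsProbabilityMeasure (P.map fun ω => E ω + g (V ω)) :=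
    Measure.isProbabilityMeasure_map hU.aemeasurable
  have : IsProbabilityMeasure (P.map fun ω => (E ω + g (V ω), V ω)) :=
    Measure.isProbabilityMeasure_map (by fun_prop)
  have hp₁ := measurable_gaussianPDF μ₁ v₁
  have hp₂ := measurable_gaussianPDF μ₂ v₂
  have hd := map_add_prodMk_eq_withDensity hE hV hg hv₁ hv₂ hind hlE hlU
  set J := P.map (fun ω => (E ω + g (V ω), V ω)) with hJ
  set Q := (P.map (fun ω => E ω + g (V ω))).prod (P.map V) with hQ
  have hr : Measurable fun z : ℝ × β =>
      gaussianPDF μ₁ v₁ (z.1 - g z.2) / gaussianPDF μ₂ v₂ z.1 := by fun_prop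
  have hac : J ≪ Q := by rw [hd]; exact withDensity_absolutelyContinuous _ _
  have hllr : llr J Q =ᵐ[J] fun z => Real.log
      (gaussianPDF μ₁ v₁ (z.1 - g z.2) / gaussianPDF μ₂ v₂ z.1).toReal := by
    have h := Measure.rnDeriv_withDensity Q hr
    rw [← hd] at h
    filter_upwards [hac.ae_le h] with z hz
    rw [llr_def]
    simp only [hz]
  have hform : ∀ ω, Real.log (gaussianPDF μ₁ v₁ ((E ω + g (V ω)) - g (V ω)) /
      gaussianPDF μ₂ v₂ (E ω + g (V ω))).toReal =
      1 / 2 * Real.log (v₂ / v₁) - (E ω - μ₁) ^ 2 / (2 * v₁) +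
        (E ω + g (V ω) - μ₂) ^ 2 / (2 * v₂) := by
    intro ω
    have h1 : (0 : ℝ) < v₁ := by positivity
    have h2 : (0 : ℝ) < v₂ := by positivity
    rw [add_sub_cancel_right, ENNReal.toReal_div, toReal_gaussianPDF, toReal_gaussianPDF,
      Real.log_div (gaussianPDFReal_pos _ _ _ hv₁).ne' (gaussianPDFReal_pos _ _ _ hv₂).ne',
      log_gaussianPDFReal _ hv₁, log_gaussianPDFReal _ hv₂, Real.log_div h2.ne' h1.ne',
      Real.log_mul (by positivity) h1.ne', Real.log_mul (by positivity) h2.ne']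
    ring
  obtain ⟨hiE, heE⟩ := integral_sub_sq_of_map_eq_gaussianReal hE hlE
  obtain ⟨hiU, heU⟩ := integral_sub_sq_of_map_eq_gaussianReal hU hlU
  have hmeas : Measurable fun z : ℝ × β => Real.log
      (gaussianPDF μ₁ v₁ (z.1 - g z.2) / gaussianPDF μ₂ v₂ z.1).toReal := by fun_prop
  have hi1 : Integrable (fun ω => 1 / 2 * Real.log (v₂ / v₁) - (E ω - μ₁) ^ 2 / (2 * v₁)) P :=
    (integrable_const _).sub (hiE.div_const _)
  have hi2 : Integrable (fun ω => (E ω + g (V ω) - μ₂) ^ 2 / (2 * v₂)) P := hiU.div_const _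
  have hint : Integrable (llr J Q) J := by
    rw [integrable_congr hllr, hJ, integrable_map_measure hmeas.aestronglyMeasurable (by fun_prop)]
    simp only [Function.comp_def, hform]
    exact hi1.add hi2
  refine ⟨InformationTheory.klDiv_ne_top hac hint, ?_⟩
  rw [mutualInfo, InformationTheory.toReal_klDiv_of_measure_eq hac (by simp),
    integral_congr_ae hllr, hJ, integral_map (by fun_prop) hmeas.aestronglyMeasurable]
  simp only [hform]
  have h1 : (v₁ : ℝ) ≠ 0 := by exact_mod_cast hv₁
  have h2 : (v₂ : ℝ) ≠ 0 := by exact_mod_cast hv₂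
  -- The two normalized quadratic terms have mean 1/2 each and opposite signs, so only the log-ratio
  -- of variances survives.
  rw [integral_add hi1 hi2, integral_sub (integrable_const _) (hiE.div_const _), integral_div,
    integral_div, heE, heU]
  simp
  field_simp
  ring

end GaussianChannel

/-! ### Almost sure limits of Gaussian vectors. -/

open Filter Topology in
/-- An almost sure limit of centered Gaussian variables with convergent variances is Gaussian. -/
lemma map_eq_gaussianReal_of_tendsto {Ω : Type*} [MeasurableSpace Ω] {P : Measure Ω}
    [IsProbabilityMeasure P] {Z : ℕ → Ω → ℝ} {Z' : Ω → ℝ} {v : ℕ → ℝ≥0} {v' : ℝ≥0}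
    (hZ : ∀ n, AEMeasurable (Z n) P) (hZ' : AEMeasurable Z' P)
    (hlaw : ∀ n, P.map (Z n) = gaussianReal 0 (v n))
    (hlim : ∀ᵐ ω ∂P, Tendsto (fun n => Z n ω) atTop (𝓝 (Z' ω)))
    (hv : Tendsto v atTop (𝓝 v')) : P.map Z' = gaussianReal 0 v' := by
  have : IsProbabilityMeasure (P.map Z') := Measure.isProbabilityMeasure_map hZ'
  have key : ∀ {Y : Ω → ℝ}, AEMeasurable Y P → ∀ t : ℝ,
      charFun (P.map Y) t = ∫ ω, Complex.exp (t * Y ω * Complex.I) ∂P := by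
    intro Y hY t
    rw [charFun_apply_real, integral_map hY (by fun_prop)]
  refine Measure.ext_of_charFun (funext fun t => ?_)
  have h1 : Tendsto (fun n => charFun (P.map (Z n)) t) atTop (𝓝 (charFun (P.map Z') t)) := by
    simp only [key hZ', fun n => key (hZ n)]
    refine tendsto_integral_of_dominated_convergence (fun _ => 1) (fun n => ?_)
      (integrable_const _) (fun n => ?_) ?_
    · have := hZ n
      exact AEMeasurable.aestronglyMeasurable (by fun_prop)
    · refine ae_of_all _ fun ω => le_of_eq ?_
      rw [← Complex.ofReal_mul, Complex.norm_exp_ofReal_mul_I]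
    · filter_upwards [hlim] with ω hω
      have hc : Continuous fun x : ℝ => Complex.exp (t * x * Complex.I) := by fun_prop
      exact (hc.tendsto _).comp hω
  have h2 : Tendsto (fun n => charFun (P.map (Z n)) t) atTop
      (𝓝 (charFun (gaussianReal 0 v') t)) := by
    simp only [hlaw, charFun_gaussianReal]
    have hc : Continuous fun x : ℝ≥0 =>
      Complex.exp (t * (0 : ℝ) * Complex.I - ((x : ℝ) : ℂ) * t ^ 2 / 2) := by fun_prop
    exact (hc.tendsto v').comp hv
  exact tendsto_nhds_unique h1 h2

open Filter Topology in
/-- An almost sure limit of centered Gaussian vectors with convergent covariances is a Gaussian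
vector, and its covariances are the limits. -/
theorem HasGaussianLaw.of_tendsto_covariance {Ω ι : Type*} [Fintype ι] [MeasurableSpace Ω]
    {P : Measure Ω} [IsProbabilityMeasure P] {Z : ℕ → ι → Ω → ℝ} {Z' : ι → Ω → ℝ} {K : ι → ι → ℝ}
    (hZ : ∀ n, HasGaussianLaw (fun ω i => Z n i ω) P) (hZ' : ∀ i, AEMeasurable (Z' i) P)
    (hmean : ∀ n i, P[Z n i] = 0)
    (hlim : ∀ i, ∀ᵐ ω ∂P, Tendsto (fun n => Z n i ω) atTop (𝓝 (Z' i ω)))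
    (hcov : ∀ i j, Tendsto (fun n => cov[Z n i, Z n j; P]) atTop (𝓝 (K i j))) :
    HasGaussianLaw (fun ω i => Z' i ω) P ∧ (∀ i, P[Z' i] = 0) ∧
      ∀ i j, cov[Z' i, Z' j; P] = K i j := by
  classical
  have hmem : ∀ n i, MemLp (Z n i) 2 P := fun n i => ((hZ n).eval i).memLp_two
  -- Cramér–Wold: it suffices to control every linear combination, which is the one-dimensional
  -- case.
  have key : ∀ c : ι → ℝ, P.map (fun ω => ∑ i, c i * Z' i ω) =
      gaussianReal 0 (∑ i, ∑ j, c i * c j * K i j).toNNReal := by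
    intro c
    have hg : ∀ n, HasGaussianLaw (fun ω => ∑ i, c i * Z n i ω) P := fun n => by
      have := (hZ n).map_fun (∑ i, c i • ContinuousLinearMap.proj (R := ℝ) (φ := fun _ : ι => ℝ) i)
      simpa using this
    have hvar : ∀ n, Var[fun ω => ∑ i, c i * Z n i ω; P] =
        ∑ i, ∑ j, c i * c j * cov[Z n i, Z n j; P] := fun n => by
      rw [← covariance_self (hg n).aemeasurable, covariance_fun_sum_fun_sum
        (fun i => (hmem n i).const_mul _) (fun i => (hmem n i).const_mul _)]
      simp only [covariance_const_mul_left, covariance_const_mul_right]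
      refine Finset.sum_congr rfl fun i _ => Finset.sum_congr rfl fun j _ => by ring
    refine map_eq_gaussianReal_of_tendsto (Z := fun n ω => ∑ i, c i * Z n i ω)
      (v := fun n => (∑ i, ∑ j, c i * c j * cov[Z n i, Z n j; P]).toNNReal)
      (fun n => (hg n).aemeasurable) (by fun_prop) (fun n => ?_) ?_ ?_
    · rw [(hg n).map_eq_gaussianReal, hvar, integral_finsetSum _
        fun i _ => ((hmem n i).integrable one_le_two).const_mul _]
      simp [integral_const_mul, hmean]
    · filter_upwards [ae_all_iff.2 hlim] with ω hω
      exact tendsto_finsetSum _ fun i _ => (hω i).const_mul _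
    · exact (continuous_real_toNNReal.tendsto _).comp
        (tendsto_finsetSum _ fun i _ => tendsto_finsetSum _ fun j _ => (hcov i j).const_mul _)
  have hgauss : HasGaussianLaw (fun ω i => Z' i ω) P := by
    refine ⟨isGaussian_of_map_eq_gaussianReal fun L => ?_⟩
    refine ⟨0, (∑ i, ∑ j, L (Pi.single i 1) * L (Pi.single j 1) * K i j).toNNReal, ?_⟩
    rw [← key, AEMeasurable.map_map_of_aemeasurable (by fun_prop) (by fun_prop)]
    congr 1
    funext ω
    simp only [Function.comp_apply]
    conv_lhs => rw [← Finset.univ_sum_single (fun i => Z' i ω)]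
    rw [map_sum]
    refine Finset.sum_congr rfl fun i _ => ?_
    have : (Pi.single i (Z' i ω) : ι → ℝ) = Z' i ω • Pi.single i 1 := by
      rw [← Pi.single_smul, smul_eq_mul, mul_one]
    rw [this, map_smul, smul_eq_mul, mul_comm]
  have hmem' : ∀ i, MemLp (Z' i) 2 P := fun i => (hgauss.eval i).memLp_two
  have hKs : ∀ i j, K i j = K j i := fun i j =>
    tendsto_nhds_unique (hcov i j) (by simpa only [covariance_comm] using hcov j i)
  -- The limiting quadratic form is a limit of variances, so the truncation `toNNReal` in `key`
  -- loses nothing.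
  have hnn : ∀ c : ι → ℝ, 0 ≤ ∑ i, ∑ j, c i * c j * K i j := by
    intro c
    refine ge_of_tendsto' (tendsto_finsetSum _ fun i _ => tendsto_finsetSum _ fun j _ =>
      (hcov i j).const_mul (c i * c j)) fun n => ?_
    have : cov[fun ω => ∑ i, c i * Z n i ω, fun ω => ∑ i, c i * Z n i ω; P] =
        ∑ i, ∑ j, c i * c j * cov[Z n i, Z n j; P] := by
      rw [covariance_fun_sum_fun_sum
        (fun i => (hmem n i).const_mul _) (fun i => (hmem n i).const_mul _)]
      simp only [covariance_const_mul_left, covariance_const_mul_right]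
      refine Finset.sum_congr rfl fun i _ => Finset.sum_congr rfl fun j _ => by ring
    rw [← this, covariance_self (Finset.aemeasurable_fun_sum _ fun i _ =>
      (hmem n i).1.aemeasurable.const_mul _)]
    exact variance_nonneg _ _
  have hvar' : ∀ c : ι → ℝ, Var[fun ω => ∑ i, c i * Z' i ω; P] =
      ∑ i, ∑ j, c i * c j * K i j := by
    intro c
    have h : HasLaw (fun ω => ∑ i, c i * Z' i ω) _ P := ⟨by fun_prop, key c⟩
    rw [h.variance_eq, variance_id_gaussianReal, Real.coe_toNNReal _ (hnn c)]
  refine ⟨hgauss, fun i => ?_, fun i j => ?_⟩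
  · have h : HasLaw (fun ω => ∑ k, (Pi.single i 1 : ι → ℝ) k * Z' k ω) _ P :=
      ⟨by fun_prop, key (Pi.single i 1)⟩
    have := h.integral_eq
    rw [integral_id_gaussianReal] at this
    simpa [Pi.single_apply] using this
  · have hd : ∀ k, Var[Z' k; P] = K k k := fun k => by
      simpa [Pi.single_apply] using hvar' (Pi.single k 1)
    -- Polarization: the variance of Z'_i + Z'_j yields the covariance.
    have hs := hvar' (Pi.single i 1 + Pi.single j 1)
    have e : (fun ω => ∑ k, (Pi.single i 1 + Pi.single j 1 : ι → ℝ) k * Z' k ω) =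
        Z' i + Z' j := by
      funext ω; simp [Pi.single_apply, add_mul, Finset.sum_add_distrib]
    rw [e, variance_add (hmem' i) (hmem' j), hd, hd] at hs
    simp [Pi.single_apply, add_mul, mul_add, Finset.sum_add_distrib, hKs j i] at hs
    linarith

/-! ### Riemann sums and the pathwise solution of the equation. -/

open Filter Topology in
/-- Convergence of left Riemann sums on `[0, 1]` for a bounded function that is continuous almost
everywhere. -/
lemma tendsto_riemann_sum {g : ℝ → ℝ} {C : ℝ} (hg : Measurable g)
    (hC : ∀ u ∈ Set.Icc (0 : ℝ) 1, |g u| ≤ C)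
    (hcont : ∀ᵐ u : ℝ, u ∈ Set.Ioc (0 : ℝ) 1 → ContinuousAt g u) :
    Tendsto (fun n : ℕ => ∑ i : Fin n, (1 / n : ℝ) * g (i / n)) atTop
      (𝓝 (∫ u in (0 : ℝ)..1, g u)) := by
  -- The sum is exactly the integral of u ↦ g(⌊nu⌋/n), which is constant inside each cell; dominated
  -- convergence then applies.
  have hstep : ∀ n : ℕ, 0 < n →
      ∫ u in (0 : ℝ)..1, g (⌊(n : ℝ) * u⌋₊ / n) = ∑ i : Fin n, (1 / n : ℝ) * g (i / n) := by
    intro n hn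
    have hn' : (0 : ℝ) < n := by exact_mod_cast hn
    have hpiece : ∀ i : ℕ, Set.EqOn (fun _ => g (i / n)) (fun u : ℝ => g (⌊(n : ℝ) * u⌋₊ / n))
        (Set.Ioo ((i : ℝ) / n) ((i + 1 : ℕ) / n)) := by
      intro i u hu
      have h1 : (i : ℝ) ≤ n * u := by
        have := (div_lt_iff₀ hn').1 hu.1; linarith
      have h2 : (n : ℝ) * u < i + 1 := by
        have := (lt_div_iff₀ hn').1 hu.2; push_cast at this; linarith
      have : ⌊(n : ℝ) * u⌋₊ = i := (Nat.floor_eq_iff ((Nat.cast_nonneg i).trans h1)).2 ⟨h1, h2⟩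
      simp only [this]
    have hle : ∀ i : ℕ, (i : ℝ) / n ≤ (i + 1 : ℕ) / n := fun i => by
      gcongr; simp
    have hint : ∀ i < n, IntervalIntegrable (fun u : ℝ => g (⌊(n : ℝ) * u⌋₊ / n)) volume
        ((i : ℝ) / n) ((i + 1 : ℕ) / n) := by
      intro i _
      refine IntervalIntegrable.congr_ae (f := fun _ => g (i / n)) intervalIntegrable_const ?_
      rw [Set.uIoc_of_le (hle i), ← restrict_Ioo_eq_restrict_Ioc]
      exact (ae_restrict_mem measurableSet_Ioo).mono fun u hu => hpiece i hu
    have h := intervalIntegral.sum_integral_adjacent_intervals (n := n)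
      (a := fun i : ℕ => (i : ℝ) / n) hint
    simp only [Nat.cast_zero, zero_div, div_self hn'.ne'] at h
    rw [← h, Fin.sum_univ_eq_sum_range (fun i => (1 / n : ℝ) * g (i / n))]
    refine Finset.sum_congr rfl fun i _ => ?_
    rw [intervalIntegral.integral_of_le (hle i), integral_Ioc_eq_integral_Ioo,
      ← setIntegral_congr_fun measurableSet_Ioo (hpiece i), setIntegral_const]
    simp only [Measure.real, Real.volume_Ioo, smul_eq_mul]
    rw [ENNReal.toReal_ofReal (by linarith [hle i])]
    push_cast
    ring
  refine Tendsto.congr' (f₁ := fun n : ℕ => ∫ u in (0 : ℝ)..1, g (⌊(n : ℝ) * u⌋₊ / n)) ?_ ?_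
  · filter_upwards [eventually_gt_atTop 0] with n hn using hstep n hn
  · refine intervalIntegral.tendsto_integral_filter_of_dominated_convergence (fun _ => C)
      ?_ ?_ intervalIntegrable_const ?_
    · refine Eventually.of_forall fun n => Measurable.aestronglyMeasurable ?_
      fun_prop
    · filter_upwards [eventually_gt_atTop 0] with n hn
      refine ae_of_all _ fun u hu => ?_
      rw [Set.uIoc_of_le zero_le_one] at hu
      have hn' : (0 : ℝ) < n := by exact_mod_cast hn
      refine hC _ ⟨by positivity, ?_⟩
      rw [div_le_one hn']
      exact (Nat.floor_le (by have := hu.1; positivity)).trans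
        (mul_le_of_le_one_right hn'.le hu.2)
    · filter_upwards [hcont] with u hu hmem
      rw [Set.uIoc_of_le zero_le_one] at hmem
      refine (hu hmem).tendsto.comp ?_
      have := (tendsto_nat_floor_mul_div_atTop hmem.1.le).comp
        (tendsto_natCast_atTop_atTop (R := ℝ))
      simpa [Function.comp_def, mul_comm] using this

/-- Variation of constants for the pathwise Ornstein-Uhlenbeck equation. -/
lemma ornsteinUhlenbeck_path_eq {κ θ σ : ℝ} {x w : ℝ≥0 → ℝ} (hx : Continuous x)
    (hw : Continuous w)
    (h : ∀ t : ℝ≥0, x t = x 0 + (∫ s in (0 : ℝ)..(t : ℝ), κ * (θ - x s.toNNReal)) + σ * w t)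
    (t : ℝ≥0) :
    x t - θ = Real.exp (-κ * t) * (x 0 - θ) + σ * (w t -
      ∫ u in (0 : ℝ)..1, κ * t * Real.exp (-κ * t * (1 - u)) * w (t * u.toNNReal)) := by
  set y : ℝ → ℝ := fun r => ∫ s in (0 : ℝ)..r, κ * (θ - x s.toNNReal) with hy
  have hxc : Continuous fun s : ℝ => κ * (θ - x s.toNNReal) := by fun_prop
  have hwc : Continuous fun s : ℝ => w s.toNNReal := by fun_prop
  have hyd : ∀ r, HasDerivAt y (κ * (θ - x r.toNNReal)) r := fun r =>
    intervalIntegral.integral_hasDerivAt_right (hxc.intervalIntegrable _ _)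
      (hxc.stronglyMeasurableAtFilter _ _) hxc.continuousAt
  have hed : ∀ r : ℝ, HasDerivAt (fun r => Real.exp (κ * r)) (Real.exp (κ * r) * κ) r := fun r => by
    simpa using ((hasDerivAt_id r).const_mul κ).exp
  -- Only the drift part y is differentiated, never w. Substituting the equation for x cancels every
  -- term except the one in w.
  have hF : ∀ r ∈ Set.uIcc (0 : ℝ) t, HasDerivAt
      (fun r => Real.exp (κ * r) * (y r - (θ - x 0)))
      (-σ * (κ * Real.exp (κ * r) * w r.toNNReal)) r := by
    intro r hr
    rw [Set.uIcc_of_le t.coe_nonneg] at hr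
    refine ((hed r).mul ((hyd r).sub_const (θ - x 0))).congr_deriv ?_
    have := h r.toNNReal
    rw [Real.coe_toNNReal r hr.1] at this
    rw [this]
    simp only [hy]
    ring
  have hI := intervalIntegral.integral_eq_sub_of_hasDerivAt hF
    (Continuous.intervalIntegrable (by fun_prop) _ _)
  have hy0 : y 0 = 0 := by simp [hy]
  rw [intervalIntegral.integral_const_mul, hy0] at hI
  -- The substitution r = tu moves the integral to [0, 1], so the same nodes i/n serve every t.
  have hsub : ∫ u in (0 : ℝ)..1, κ * t * Real.exp (-κ * t * (1 - u)) * w (t * u.toNNReal) =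
      Real.exp (-κ * t) * ∫ r in (0 : ℝ)..t, κ * Real.exp (κ * r) * w r.toNNReal := by
    have := intervalIntegral.mul_integral_comp_mul_left (a := 0) (b := 1) (c := (t : ℝ))
      (f := fun r => κ * Real.exp (κ * r) * w r.toNNReal)
    simp only [mul_zero, mul_one] at this
    rw [← this, ← mul_assoc, ← intervalIntegral.integral_const_mul]
    refine intervalIntegral.integral_congr fun u _ => ?_
    have e : Real.exp (-κ * t * (1 - u)) = Real.exp (-κ * t) * Real.exp (κ * (t * u)) := by
      rw [← Real.exp_add]; ring_nf
    have e2 : ((t : ℝ) * u).toNNReal = t * u.toNNReal := by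
      rw [Real.toNNReal_mul t.coe_nonneg, Real.toNNReal_coe]
    simp only [e, e2]
    ring
  have hee : Real.exp (-κ * t) * Real.exp (κ * t) = 1 := by
    rw [← Real.exp_add]; simp
  have ht := h t
  change x t = x 0 + y t + σ * w t at ht
  rw [hsub, ht]
  simp only [mul_zero, Real.exp_zero, one_mul, zero_sub] at hI
  have := congrArg (Real.exp (-κ * t) * ·) hI
  linear_combination (y t - (θ - x 0)) * (-hee) - this

/-! ### Brownian covariances as L² inner products. -/

/-- The indicator function of `(0, u]`, whose `L²` inner products are the covariances of Brownian
motion. -/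
noncomputable def brownianKernel (u : ℝ≥0) : ℝ → ℝ := (Set.Ioc 0 (u : ℝ)).indicator 1

lemma measurable_brownianKernel (u : ℝ≥0) : Measurable (brownianKernel u) :=
  measurable_one.indicator measurableSet_Ioc

lemma brownianKernel_mul (u w : ℝ≥0) :
    (fun v => brownianKernel u v * brownianKernel w v) = brownianKernel (min u w) := by
  funext v
  simp only [brownianKernel, Set.indicator_apply, Set.mem_Ioc, NNReal.coe_min, le_min_iff]
  split_ifs <;> simp_all

lemma integrable_brownianKernel (u : ℝ≥0) : Integrable (brownianKernel u) :=
  (integrable_indicator_iff measurableSet_Ioc).2 (integrableOn_const (by simp))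

lemma integral_brownianKernel (u : ℝ≥0) : ∫ v, brownianKernel u v = u := by
  rw [brownianKernel, integral_indicator_one measurableSet_Ioc]
  simp [Measure.real]

section Covariance

variable {Ω : Type*} [MeasurableSpace Ω] {P : Measure Ω} {W : ℝ≥0 → Ω → ℝ}

/-- The Wiener isometry for finite sums: min(u, u') is the inner product of the two indicators, and
both sides are bilinear. -/
lemma IsPreBrownianReal.covariance_sum_sum (hW : IsPreBrownianReal W P) {ι ι' : Type*} [Fintype ι]
    [Fintype ι'] (a : ι → ℝ) (b : ι' → ℝ) (u : ι → ℝ≥0) (u' : ι' → ℝ≥0) :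
    cov[fun ω => ∑ i, a i * W (u i) ω, fun ω => ∑ j, b j * W (u' j) ω; P] =
      ∫ v, (∑ i, a i * brownianKernel (u i) v) * ∑ j, b j * brownianKernel (u' j) v := by
  have := hW.isGaussianProcess.isProbabilityMeasure
  have hmem : ∀ t, MemLp (W t) 2 P := fun t => (hW.isGaussianProcess.hasGaussianLaw_eval t).memLp_two
  rw [covariance_fun_sum_fun_sum (fun i => (hmem _).const_mul _) (fun i => (hmem _).const_mul _)]
  have e : ∀ i j v, a i * brownianKernel (u i) v * (b j * brownianKernel (u' j) v) =
      a i * b j * brownianKernel (min (u i) (u' j)) v := fun i j v => by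
    rw [← brownianKernel_mul]; ring
  simp only [covariance_const_mul_left, covariance_const_mul_right, hW.covariance_eval,
    Finset.sum_mul_sum, e]
  rw [integral_finsetSum _ fun i _ => integrable_finsetSum _ fun j _ =>
    (integrable_brownianKernel _).const_mul _]
  refine Finset.sum_congr rfl fun i _ => ?_
  rw [integral_finsetSum _ fun j _ => (integrable_brownianKernel _).const_mul _]
  refine Finset.sum_congr rfl fun j _ => ?_
  rw [integral_const_mul, integral_brownianKernel]
  push_cast
  ring

end Covariance

/-! ### Discretized Ornstein–Uhlenbeck kernels and their limits. -/

section Discretization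

/-- Weights of the `n`-point discretization of `W_t - ∫₀ᵗ κ e^{-κ (t - r)} W_r dr`. -/
noncomputable def ouWeight (κ : ℝ) (n : ℕ) (t : ℝ≥0) : Option (Fin n) → ℝ
  | none => 1
  | some i => -((1 / n : ℝ) * (κ * t * Real.exp (-κ * t * (1 - i / n))))

/-- Times of the `n`-point discretization of `W_t - ∫₀ᵗ κ e^{-κ (t - r)} W_r dr`. -/
noncomputable def ouTime (n : ℕ) (t : ℝ≥0) : Option (Fin n) → ℝ≥0
  | none => t
  | some i => t * ((i : ℝ) / n).toNNReal

variable {κ : ℝ} {t : ℝ≥0} {v : ℝ}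

lemma measurable_brownianKernel_mul (t : ℝ≥0) (v : ℝ) :
    Measurable fun u : ℝ => brownianKernel (t * u.toNNReal) v := by
  have : (fun u : ℝ => brownianKernel (t * u.toNNReal) v) =
      {u : ℝ | 0 < v ∧ v ≤ t * u.toNNReal}.indicator 1 := by
    funext u
    simp [brownianKernel, Set.indicator_apply]
  rw [this]
  refine measurable_one.indicator ?_
  exact (MeasurableSet.const _).inter (measurableSet_le (g := fun u : ℝ => (t : ℝ) * u.toNNReal)
    measurable_const (by fun_prop))

lemma abs_brownianKernel_le_one (u : ℝ≥0) (v : ℝ) : |brownianKernel u v| ≤ 1 := by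
  rw [brownianKernel, Set.indicator_apply]; split_ifs <;> simp

lemma brownianKernel_of_le {u t : ℝ≥0} (h : u ≤ t) (v : ℝ) :
    brownianKernel u v = brownianKernel u v * brownianKernel t v := by
  rw [show brownianKernel u v * brownianKernel t v = brownianKernel (min u t) v from
    congrFun (brownianKernel_mul u t) v, min_eq_left h]

lemma ouTime_le (n : ℕ) (t : ℝ≥0) (i : Option (Fin n)) : ouTime n t i ≤ t := by
  cases i with
  | none => exact le_rfl
  | some i =>
    refine mul_le_of_le_one_right' ?_
    rw [Real.toNNReal_le_one]
    refine div_le_one_of_le₀ ?_ (by positivity)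
    exact_mod_cast i.2.le

lemma abs_exp_weight_le (hκ : 0 ≤ κ) {u : ℝ} (hu : u ≤ 1) :
    |κ * t * Real.exp (-κ * t * (1 - u))| ≤ κ * t := by
  rw [abs_of_nonneg (by positivity)]
  refine mul_le_of_le_one_right (by positivity) (Real.exp_le_one_iff.2 ?_)
  have : 0 ≤ κ * t * (1 - u) := mul_nonneg (by positivity) (by linarith)
  linarith

/-- An integrable bound uniform in n, for dominated convergence: the weights have total mass at most
1 + κt, and all kernels live on (0, t]. -/
lemma abs_sum_ouWeight_le (hκ : 0 < κ) (n : ℕ) (t : ℝ≥0) (v : ℝ) :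
    |∑ i, ouWeight κ n t i * brownianKernel (ouTime n t i) v| ≤ (1 + κ * t) * brownianKernel t v := by
  have h0 : 0 ≤ brownianKernel t v := Set.indicator_nonneg (fun _ _ => zero_le_one) _
  have hsum : ∑ i, |ouWeight κ n t i| ≤ 1 + κ * t := by
    rw [Fintype.sum_option]
    simp only [ouWeight, abs_one, abs_neg, abs_mul]
    gcongr
    calc ∑ i : Fin n, |(1 / n : ℝ)| * (|κ| * |(t : ℝ)| * |Real.exp (-κ * t * (1 - i / n))|)
        ≤ ∑ i : Fin n, (1 / n : ℝ) * (κ * t) := by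
          refine Finset.sum_le_sum fun i _ => ?_
          rw [abs_of_nonneg (by positivity : (0 : ℝ) ≤ 1 / n), ← abs_mul, ← abs_mul]
          refine mul_le_mul_of_nonneg_left (abs_exp_weight_le hκ.le ?_) (by positivity)
          exact div_le_one_of_le₀ (by exact_mod_cast i.2.le) (by positivity)
      _ ≤ κ * t := by
          rw [Finset.sum_const, Finset.card_univ, Fintype.card_fin, nsmul_eq_mul, ← mul_assoc]
          refine mul_le_of_le_one_left (by positivity) ?_
          rw [mul_one_div]; exact div_self_le_one _
  calc |∑ i, ouWeight κ n t i * brownianKernel (ouTime n t i) v|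
      ≤ ∑ i, |ouWeight κ n t i * brownianKernel (ouTime n t i) v| := Finset.abs_sum_le_sum_abs _ _
    _ ≤ ∑ i, |ouWeight κ n t i| * brownianKernel t v := by
        refine Finset.sum_le_sum fun i _ => ?_
        rw [abs_mul, brownianKernel_of_le (ouTime_le n t i), abs_mul, abs_of_nonneg h0]
        refine mul_le_mul_of_nonneg_left ?_ (abs_nonneg _)
        exact mul_le_of_le_one_left h0 (abs_brownianKernel_le_one _ _)
    _ ≤ _ := by
        rw [← Finset.sum_mul]
        exact mul_le_mul_of_nonneg_right hsum h0

open Filter Topology in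
lemma tendsto_sum_ouWeight_path {w : ℝ≥0 → ℝ} (hw : Continuous w) (t : ℝ≥0) :
    Tendsto (fun n => ∑ i, ouWeight κ n t i * w (ouTime n t i)) atTop
      (𝓝 (w t - ∫ u in (0 : ℝ)..1,
        κ * t * Real.exp (-κ * t * (1 - u)) * w (t * u.toNNReal))) := by
  have hc : Continuous fun u : ℝ => κ * t * Real.exp (-κ * t * (1 - u)) * w (t * u.toNNReal) := by
    fun_prop
  obtain ⟨C, hC⟩ := isCompact_Icc.exists_bound_of_continuousOn (hc.continuousOn (s := Set.Icc 0 1))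
  have := (tendsto_riemann_sum hc.measurable hC (ae_of_all _ fun u _ => hc.continuousAt)).const_sub
    (w t)
  refine this.congr fun n => ?_
  rw [Fintype.sum_option, sub_eq_add_neg, ← Finset.sum_neg_distrib]
  simp only [ouWeight, ouTime, one_mul, add_right_inj]
  refine Finset.sum_congr rfl fun i _ => by ring

lemma integral_exp_weight_brownianKernel (κ : ℝ) (t : ℝ≥0) (v : ℝ) :
    ∫ u in (0 : ℝ)..1, κ * t * Real.exp (-κ * t * (1 - u)) * brownianKernel (t * u.toNNReal) v =
      brownianKernel t v * (1 - Real.exp (-κ * (t - v))) := by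
  by_cases hv : v ∈ Set.Ioc 0 (t : ℝ)
  · have ht : (0 : ℝ) < t := hv.1.trans_le hv.2
    have hvt0 : 0 < v / t := div_pos hv.1 ht
    have hvt1 : v / t ≤ 1 := (div_le_one ht).2 hv.2
    have e : ∀ u ∈ Set.Ioc (0 : ℝ) 1, κ * t * Real.exp (-κ * t * (1 - u)) *
        brownianKernel (t * u.toNNReal) v = (Set.Icc (v / t) 1).indicator
          (fun u => κ * t * Real.exp (-κ * t * (1 - u))) u := by
      intro u hu
      have : v / t ≤ u ↔ v ≤ t * u := by rw [div_le_iff₀ ht, mul_comm]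
      simp only [brownianKernel, Set.indicator_apply, Set.mem_Ioc, Set.mem_Icc, hv.1, hu.2,
        NNReal.coe_mul, Real.coe_toNNReal u hu.1.le, this, true_and, and_true]
      split_ifs <;> simp
    rw [intervalIntegral.integral_of_le zero_le_one, setIntegral_congr_fun measurableSet_Ioc e,
      setIntegral_indicator measurableSet_Icc]
    have hset : Set.Ioc (0 : ℝ) 1 ∩ Set.Icc (v / t) 1 = Set.Icc (v / t) 1 :=
      Set.inter_eq_right.2 fun u hu => ⟨hvt0.trans_le hu.1, hu.2⟩
    rw [hset, integral_Icc_eq_integral_Ioc, ← intervalIntegral.integral_of_le hvt1]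
    have hd : ∀ u ∈ Set.uIcc (v / t) 1, HasDerivAt (fun u => Real.exp (-κ * t * (1 - u)))
        (κ * t * Real.exp (-κ * t * (1 - u))) u := by
      intro u _
      refine (((hasDerivAt_id u).const_sub 1).const_mul (-κ * t)).exp.congr_deriv ?_
      simp only [id]; ring
    rw [intervalIntegral.integral_eq_sub_of_hasDerivAt hd
      (Continuous.intervalIntegrable (by fun_prop) _ _)]
    simp only [brownianKernel, Set.indicator_of_mem hv, Pi.one_apply, one_mul, sub_self, mul_zero,
      Real.exp_zero]
    congr 2
    field_simp
  · have : ∀ u ∈ Set.uIcc (0 : ℝ) 1, κ * t * Real.exp (-κ * t * (1 - u)) *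
        brownianKernel (t * u.toNNReal) v = 0 := by
      intro u hu
      rw [Set.uIcc_of_le zero_le_one] at hu
      rw [brownianKernel_of_le (mul_le_of_le_one_right' (Real.toNNReal_le_one.2 hu.2) :
        t * u.toNNReal ≤ t)]
      simp [brownianKernel, Set.indicator_of_notMem hv]
    rw [intervalIntegral.integral_congr (g := fun _ => 0) this]
    simp [brownianKernel, Set.indicator_of_notMem hv]

-- The limit is the kernel of the stochastic convolution ∫₀ᵗ e^{-κ(t-v)} dW_v, obtained pointwise in
-- v as indicator minus Riemann integral.
open Filter Topology in
lemma tendsto_sum_ouWeight_brownianKernel (hκ : 0 < κ) (t : ℝ≥0) (v : ℝ) :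
    Tendsto (fun n => ∑ i, ouWeight κ n t i * brownianKernel (ouTime n t i) v) atTop
      (𝓝 (brownianKernel t v * Real.exp (-κ * (t - v)))) := by
  have hm : Measurable fun u : ℝ => κ * t * Real.exp (-κ * t * (1 - u)) *
      brownianKernel (t * u.toNNReal) v := by
    have := measurable_brownianKernel_mul t v
    fun_prop
  have hC : ∀ u ∈ Set.Icc (0 : ℝ) 1, |κ * t * Real.exp (-κ * t * (1 - u)) *
      brownianKernel (t * u.toNNReal) v| ≤ κ * t := by
    intro u hu
    rw [abs_mul]
    exact (mul_le_of_le_one_right (abs_nonneg _) (abs_brownianKernel_le_one _ _)).trans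
      (abs_exp_weight_le hκ.le hu.2)
  -- For t > 0 the integrand can jump only at u = v/t, a null set; for t = 0 it vanishes.
  have hcont : ∀ᵐ u : ℝ, u ∈ Set.Ioc (0 : ℝ) 1 → ContinuousAt (fun u : ℝ =>
      κ * t * Real.exp (-κ * t * (1 - u)) * brownianKernel (t * u.toNNReal) v) u := by
    rcases eq_or_ne t 0 with rfl | ht
    · simp [continuousAt_const]
    · have ht' : (0 : ℝ) < t := by positivity
      filter_upwards [Measure.ae_ne volume (v / t)] with u hu _
      have hne : (t : ℝ) * u.toNNReal ≠ v ∨ v ≤ 0 := by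
        by_contra! hcon
        have h0 : 0 < u := by
          by_contra! h
          rw [Real.toNNReal_of_nonpos h] at hcon
          simp at hcon
          linarith
        rw [Real.coe_toNNReal u h0.le] at hcon
        exact hu (by rw [← hcon.1]; field_simp)
      refine ContinuousAt.mul (by fun_prop) ?_
      have hcm : ContinuousAt (fun u : ℝ => (t : ℝ) * u.toNNReal) u := by fun_prop
      refine ContinuousAt.congr (f := fun _ => brownianKernel (t * u.toNNReal) v)
        continuousAt_const ?_
      rcases hne with hne | hv
      · rcases lt_or_gt_of_ne hne with h | h
        · filter_upwards [hcm.eventually_lt_const h] with y hy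
          simp only [brownianKernel, Set.indicator_apply, Set.mem_Ioc, NNReal.coe_mul, h.not_ge,
            hy.not_ge]
        · filter_upwards [hcm.eventually_const_lt h] with y hy
          simp only [brownianKernel, Set.indicator_apply, Set.mem_Ioc, NNReal.coe_mul, h.le, hy.le]
      · refine Eventually.of_forall fun y => ?_
        simp [brownianKernel, hv.not_gt]
  have := (tendsto_riemann_sum hm hC hcont).const_sub (brownianKernel t v)
  rw [integral_exp_weight_brownianKernel] at this
  convert this using 2
  · rw [Fintype.sum_option, sub_eq_add_neg, ← Finset.sum_neg_distrib]
    simp only [ouWeight, ouTime, one_mul, add_right_inj]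
    refine Finset.sum_congr rfl fun i _ => by ring
  · ring

lemma integral_ouKernel_mul (hκ : 0 < κ) (s t : ℝ≥0) :
    ∫ v, brownianKernel s v * Real.exp (-κ * (s - v)) *
      (brownianKernel t v * Real.exp (-κ * (t - v))) =
      (Real.exp (-κ * |(s : ℝ) - t|) - Real.exp (-κ * (s + t))) / (2 * κ) := by
  have e : ∀ v, brownianKernel s v * Real.exp (-κ * (s - v)) *
      (brownianKernel t v * Real.exp (-κ * (t - v))) =
      (Set.Ioc 0 ((min s t : ℝ≥0) : ℝ)).indicator
        (fun v => Real.exp (-κ * (s + t) + 2 * κ * v)) v := by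
    intro v
    rw [mul_mul_mul_comm, show brownianKernel s v * brownianKernel t v = _ from
      congrFun (brownianKernel_mul s t) v, ← Real.exp_add, brownianKernel]
    simp only [Set.indicator_apply]
    split_ifs
    · rw [Pi.one_apply, one_mul]; ring_nf
    · simp
  simp only [e]
  rw [integral_indicator measurableSet_Ioc, ← intervalIntegral.integral_of_le (min s t).coe_nonneg]
  have hd : ∀ v ∈ Set.uIcc 0 ((min s t : ℝ≥0) : ℝ), HasDerivAt
      (fun v => Real.exp (-κ * (s + t) + 2 * κ * v) / (2 * κ))
      (Real.exp (-κ * (s + t) + 2 * κ * v)) v := by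
    intro v _
    refine (((((hasDerivAt_id v).const_mul (2 * κ)).const_add (-κ * (s + t))).exp).div_const
      (2 * κ)).congr_deriv ?_
    simp only [id]
    field_simp
  rw [intervalIntegral.integral_eq_sub_of_hasDerivAt hd
    (Continuous.intervalIntegrable (by fun_prop) _ _), ← sub_div]
  congr 3
  -- The upper endpoint contributes 2 min(s,t) - s - t = -|s - t|.
  · rcases le_total s t with h | h
    · have h' : (s : ℝ) ≤ t := h
      rw [min_eq_left h, abs_of_nonpos (by linarith)]; ring
    · have h' : (t : ℝ) ≤ s := h
      rw [min_eq_right h, abs_of_nonneg (by linarith)]; ring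
  · ring

open Filter Topology in
lemma tendsto_integral_sum_ouWeight_mul (hκ : 0 < κ) (s t : ℝ≥0) :
    Tendsto (fun n => ∫ v, (∑ i, ouWeight κ n s i * brownianKernel (ouTime n s i) v) *
        ∑ j, ouWeight κ n t j * brownianKernel (ouTime n t j) v) atTop
      (𝓝 ((Real.exp (-κ * |(s : ℝ) - t|) - Real.exp (-κ * (s + t))) / (2 * κ))) := by
  rw [← integral_ouKernel_mul hκ]
  refine tendsto_integral_of_dominated_convergence
    (fun v => (1 + κ * s) * (1 + κ * t) * brownianKernel (min s t) v) (fun n => ?_)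
    ((integrable_brownianKernel _).const_mul _) (fun n => ae_of_all _ fun v => ?_)
    (ae_of_all _ fun v => (tendsto_sum_ouWeight_brownianKernel hκ s v).mul
      (tendsto_sum_ouWeight_brownianKernel hκ t v))
  · have := measurable_brownianKernel
    exact Measurable.aestronglyMeasurable (by fun_prop)
  · rw [Real.norm_eq_abs, abs_mul, ← brownianKernel_mul]
    refine (mul_le_mul (abs_sum_ouWeight_le hκ n s v) (abs_sum_ouWeight_le hκ n t v)
      (abs_nonneg _) ((abs_nonneg _).trans (abs_sum_ouWeight_le hκ n s v))).trans_eq ?_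
    ring

end Discretization

lemma IsGaussianProcess.hasGaussianLaw_comp {Ω T ι : Type*} [MeasurableSpace Ω] {P : Measure Ω} [Fintype ι]
    {X : T → Ω → ℝ}
    (hX : IsGaussianProcess X P) (τ : ι → T) : HasGaussianLaw (fun ω i => X (τ i) ω) P := by
  classical
  exact (hX.hasGaussianLaw (Finset.univ.image τ)).map_fun
    (ContinuousLinearMap.pi fun i => ContinuousLinearMap.proj (R := ℝ)
      (φ := fun _ : Finset.univ.image τ => ℝ) ⟨τ i, by simp⟩)

/-! ### Finite-dimensional laws of the stationary process. -/

section StationaryOU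

variable {Ω : Type*} [MeasurableSpace Ω] {P : Measure Ω} [IsProbabilityMeasure P]

variable {κ θ σ : ℝ} {X W : ℝ≥0 → Ω → ℝ}

/-- Finite-dimensional laws of the stationary Ornstein-Uhlenbeck process, centered at `θ`. -/
theorem IsStationaryOU.hasGaussianLaw (hκ : 0 < κ) (hX : IsStationaryOU κ θ σ X W P) {ι : Type*}
    [Fintype ι] (τ : ι → ℝ≥0) :
    HasGaussianLaw (fun ω i => X (τ i) ω - θ) P ∧ (∀ i, P[fun ω => X (τ i) ω - θ] = 0) ∧
      ∀ i j, cov[fun ω => X (τ i) ω - θ, fun ω => X (τ j) ω - θ; P] =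
        σ ^ 2 / (2 * κ) * Real.exp (-κ * |(τ i : ℝ) - τ j|) := by
  have hW : IsPreBrownianReal W P := hX.brownian.toIsPreBrownianReal
  have hX0 : HasLaw (X 0) (gaussianReal θ (σ ^ 2 / (2 * κ)).toNNReal) P :=
    ⟨(hX.measurable 0).aemeasurable, hX.law_init⟩
  have hX0c := gaussianReal_sub_const hX0 θ
  rw [sub_self] at hX0c
  have hWm : ∀ t, MemLp (W t) 2 P := fun t =>
    (hW.isGaussianProcess.hasGaussianLaw_eval t).memLp_two
  have hX0m : MemLp (fun ω => X 0 ω - θ) 2 P := hX0c.hasGaussianLaw.memLp_two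
  have hSm : ∀ n t, MemLp (fun ω => ∑ k, ouWeight κ n t k * W (ouTime n t k) ω) 2 P := fun n t =>
    memLp_finsetSum _ fun k _ => (hWm _).const_mul _
  have hind : ∀ n t, IndepFun (fun ω => X 0 ω - θ)
      (fun ω => ∑ k, ouWeight κ n t k * W (ouTime n t k) ω) P := fun n t =>
    hX.indep_init.comp (φ := fun x => x - θ)
      (ψ := fun w : ℝ≥0 → ℝ => ∑ k, ouWeight κ n t k * w (ouTime n t k)) (by fun_prop) (by fun_prop)
  refine HasGaussianLaw.of_tendsto_covariance
    (Z := fun n i ω => Real.exp (-κ * τ i) * (X 0 ω - θ) +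
      σ * ∑ k, ouWeight κ n (τ i) k * W (ouTime n (τ i) k) ω)
    (fun n => ?_) (fun i => ((hX.measurable _).sub_const _).aemeasurable) (fun n i => ?_)
    (fun i => ?_) (fun i j => ?_)
  · have h1 := IsGaussianProcess.hasGaussianLaw_comp hW.isGaussianProcess
      (fun p : ι × Option (Fin n) => ouTime n (τ p.1) p.2)
    have h2 : IndepFun (fun ω => X 0 ω - θ)
        (fun ω (p : ι × Option (Fin n)) => W (ouTime n (τ p.1) p.2) ω) P :=
      hX.indep_init.comp (φ := fun x => x - θ)
        (ψ := fun (w : ℝ≥0 → ℝ) (p : ι × Option (Fin n)) => w (ouTime n (τ p.1) p.2))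
        (by fun_prop) (by fun_prop)
    have h3 := (h2.hasGaussianLaw hX0c.hasGaussianLaw h1).map_fun
      (ContinuousLinearMap.pi fun i =>
        Real.exp (-κ * τ i) • ContinuousLinearMap.fst ℝ ℝ (ι × Option (Fin n) → ℝ) +
        σ • ∑ k, ouWeight κ n (τ i) k • (ContinuousLinearMap.proj (R := ℝ)
          (φ := fun _ : ι × Option (Fin n) => ℝ) (i, k)).comp
            (ContinuousLinearMap.snd ℝ ℝ (ι × Option (Fin n) → ℝ)))
    refine h3.congr (ae_of_all _ fun ω => ?_)
    ext i
    simp [mul_add]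
  · rw [integral_add ((hX0m.integrable one_le_two).const_mul _)
      (((hSm n _).integrable one_le_two).const_mul _), integral_const_mul, integral_const_mul,
      hX0c.integral_eq, integral_id_gaussianReal,
      integral_finsetSum _ fun k _ => ((hWm _).integrable one_le_two).const_mul _]
    simp [integral_const_mul, hW.integral_eval]
  · filter_upwards [hX.continuous_paths, hX.brownian.cont, hX.sde] with ω h1 h2 h3
    rw [ornsteinUhlenbeck_path_eq h1 h2 h3 (τ i)]
    exact ((tendsto_sum_ouWeight_path h2 (τ i)).const_mul σ).const_add _
  · have hcov : ∀ n, cov[fun ω => Real.exp (-κ * τ i) * (X 0 ω - θ) +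
          σ * ∑ k, ouWeight κ n (τ i) k * W (ouTime n (τ i) k) ω,
        fun ω => Real.exp (-κ * τ j) * (X 0 ω - θ) +
          σ * ∑ k, ouWeight κ n (τ j) k * W (ouTime n (τ j) k) ω; P] =
        σ ^ 2 / (2 * κ) * Real.exp (-κ * (τ i + τ j)) + σ ^ 2 *
          ∫ v, (∑ k, ouWeight κ n (τ i) k * brownianKernel (ouTime n (τ i) k) v) *
            ∑ l, ouWeight κ n (τ j) l * brownianKernel (ouTime n (τ j) l) v := by
      intro n
      have e1 : ∀ t, MemLp (fun ω => Real.exp (-κ * t) * (X 0 ω - θ)) 2 P := fun t =>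
        hX0m.const_mul _
      have e2 : ∀ t, MemLp (fun ω => σ * ∑ k, ouWeight κ n t k * W (ouTime n t k) ω) 2 P :=
        fun t => (hSm n t).const_mul _
      have hv : cov[fun ω => X 0 ω - θ, fun ω => X 0 ω - θ; P] = σ ^ 2 / (2 * κ) := by
        rw [covariance_self hX0c.aemeasurable, hX0c.variance_eq, variance_id_gaussianReal,
          Real.coe_toNNReal _ (by positivity)]
      have hc : ∀ t, cov[fun ω => X 0 ω - θ,
          fun ω => ∑ k, ouWeight κ n t k * W (ouTime n t k) ω; P] = 0 := fun t =>
        (hind n t).covariance_eq_zero hX0m (hSm n t)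
      have hc' : ∀ t, cov[fun ω => ∑ k, ouWeight κ n t k * W (ouTime n t k) ω,
          fun ω => X 0 ω - θ; P] = 0 := fun t => by rw [covariance_comm]; exact hc t
      have hadd : ∀ {A B C D : Ω → ℝ}, MemLp A 2 P → MemLp B 2 P → MemLp C 2 P → MemLp D 2 P →
          cov[fun ω => A ω + B ω, fun ω => C ω + D ω; P] =
            cov[A, C; P] + cov[A, D; P] + (cov[B, C; P] + cov[B, D; P]) := by
        intro A B C D hA hB hC hD
        change cov[A + B, C + D; P] = _
        rw [covariance_add_left hA hB (hC.add hD), covariance_add_right hA hC hD,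
          covariance_add_right hB hC hD]
      rw [hadd (e1 _) (e2 _) (e1 _) (e2 _)]
      simp only [covariance_const_mul_left, covariance_const_mul_right, hv, hc, hc',
        IsPreBrownianReal.covariance_sum_sum hW]
      have : Real.exp (-κ * (τ i + τ j)) = Real.exp (-κ * τ i) * Real.exp (-κ * τ j) := by
        rw [← Real.exp_add]; ring_nf
      rw [this]
      ring
    simp only [hcov]
    -- Stationarity: the e^{-κ(τ_i+τ_j)} term coming from X_0 cancels the one in the noise
    -- covariance.
    convert ((tendsto_integral_sum_ouWeight_mul hκ (τ i) (τ j)).const_mul (σ ^ 2)).const_add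
      (σ ^ 2 / (2 * κ) * Real.exp (-κ * (τ i + τ j))) using 2
    field_simp
    ring

end StationaryOU

/-! ### The perturbed linear system (1 + γR)x = r. -/

section LinearSystem

variable {m : ℕ} {R : Matrix (Fin m) (Fin m) ℝ} {r x : Fin m → ℝ} {γ : ℝ}

lemma abs_sum_mul_le {c : ℝ} {a y : Fin m → ℝ} (ha : ∀ j, |a j| ≤ 1) (hy : ∀ j, |y j| ≤ c) :
    |∑ j, a j * y j| ≤ m * c := by
  calc |∑ j, a j * y j| ≤ ∑ j, |a j * y j| := Finset.abs_sum_le_sum_abs _ _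
    _ ≤ ∑ _j : Fin m, c := Finset.sum_le_sum fun j _ => by
        rw [abs_mul]
        exact (mul_le_of_le_one_left (abs_nonneg _) (ha j)).trans (hy j)
    _ = m * c := by simp

/-- A priori bound in the sup norm for the system `(1 + γ R) x = r` with small `γ`. -/
lemma norm_le_of_add_smul_eq (hR : ∀ i j, |R i j| ≤ 1) (hγ : 0 ≤ γ) (hγm : γ * m ≤ 1 / 2)
    (hx : ∀ i, x i + γ * ∑ j, R i j * x j = r i) : ‖x‖ ≤ 2 * ‖r‖ := by
  have h : ‖x‖ ≤ ‖r‖ + γ * (m * ‖x‖) := by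
    refine (pi_norm_le_iff_of_nonneg (by positivity)).2 fun i => ?_
    have h1 := abs_sum_mul_le (hR i) fun j => norm_le_pi_norm x j
    have h2 := norm_le_pi_norm r i
    have h3 : x i = r i - γ * ∑ j, R i j * x j := by linarith [hx i]
    rw [h3]
    refine (norm_sub_le _ _).trans (add_le_add h2 ?_)
    rw [norm_mul, Real.norm_of_nonneg hγ]
    exact mul_le_mul_of_nonneg_left h1 hγ
  -- As γm ≤ 1/2, the term γm‖x‖ is absorbed into the left side.
  nlinarith [norm_nonneg x]

/-- The a priori bound makes the operator injective, hence surjective in finite dimension. -/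
lemma exists_add_smul_eq (hR : ∀ i j, |R i j| ≤ 1) (hγ : 0 ≤ γ) (hγm : γ * m ≤ 1 / 2)
    (r : Fin m → ℝ) : ∃ x : Fin m → ℝ, ∀ i, x i + γ * ∑ j, R i j * x j = r i := by
  let T : (Fin m → ℝ) →ₗ[ℝ] (Fin m → ℝ) := LinearMap.id + γ • R.mulVecLin
  have hT : ∀ y i, T y i = y i + γ * ∑ j, R i j * y j := fun y i => by
    simp [T, Matrix.mulVec, dotProduct]
  have hinj : Function.Injective T := by
    refine (injective_iff_map_eq_zero T).2 fun y hy => ?_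
    have := norm_le_of_add_smul_eq (r := 0) (x := y) hR hγ hγm fun i => by rw [← hT, hy]
    simpa using this
  obtain ⟨x, hx⟩ := LinearMap.injective_iff_surjective.1 hinj r
  exact ⟨x, fun i => by rw [← hT, hx]⟩

/-- Second-order expansion of the quadratic form of `(1 + γ R)⁻¹`. -/
lemma abs_dotProduct_sub_le (hR : ∀ i j, |R i j| ≤ 1) (hr : ∀ i, |r i| ≤ 1) (hγ : 0 ≤ γ)
    (hγm : γ * m ≤ 1 / 2) (hx : ∀ i, x i + γ * ∑ j, R i j * x j = r i) :
    |∑ i, r i * x i| ≤ 2 * m ∧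
      |∑ i, r i * x i - (∑ i, r i * r i - γ * ∑ i, ∑ j, r i * R i j * r j)| ≤
        2 * m ^ 3 * γ ^ 2 := by
  have hxn : ∀ i, |x i| ≤ 2 := fun i => by
    have h1 := norm_le_of_add_smul_eq hR hγ hγm hx
    have h2 : ‖r‖ ≤ 1 := (pi_norm_le_iff_of_nonneg zero_le_one).2 hr
    exact (norm_le_pi_norm x i).trans (by linarith)
  have hRx : ∀ i, |∑ j, R i j * x j| ≤ m * 2 := fun i => abs_sum_mul_le (hR i) hxn
  have hRRx : ∀ i, |∑ j, R i j * ∑ k, R j k * x k| ≤ m * (m * 2) := fun i =>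
    abs_sum_mul_le (hR i) hRx
  refine ⟨(abs_sum_mul_le hr hxn).trans_eq (mul_comm _ _), ?_⟩
  -- Inserting the system into itself gives the exact identity x = r - γRr + γ²R²x, so no Neumann
  -- series has to be summed.
  have hexp : ∀ i, x i = r i - γ * ∑ j, R i j * r j + γ ^ 2 * ∑ j, R i j * ∑ k, R j k * x k := by
    intro i
    have e : ∑ j, R i j * x j = ∑ j, R i j * r j - γ * ∑ j, R i j * ∑ k, R j k * x k := by
      rw [Finset.mul_sum, ← Finset.sum_sub_distrib]
      refine Finset.sum_congr rfl fun j _ => ?_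
      rw [← hx j]; ring
    have := hx i
    rw [e] at this
    linarith
  have hsum : ∑ i, r i * x i - (∑ i, r i * r i - γ * ∑ i, ∑ j, r i * R i j * r j) =
      γ ^ 2 * ∑ i, r i * ∑ j, R i j * ∑ k, R j k * x k := by
    rw [Finset.sum_congr rfl fun i _ => congrArg (r i * ·) (hexp i)]
    simp only [mul_add, mul_sub, Finset.sum_add_distrib, Finset.sum_sub_distrib, Finset.mul_sum]
    have e1 : ∀ i j, r i * (γ * (R i j * r j)) = γ * (r i * R i j * r j) := fun i j => by ring
    have e2 : ∀ i j k, r i * (γ ^ 2 * (R i j * (R j k * x k))) =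
      γ ^ 2 * (r i * (R i j * (R j k * x k))) := fun i j k => by ring
    simp only [e1, e2]
    ring
  rw [hsum, abs_mul, abs_of_nonneg (sq_nonneg γ)]
  have := abs_sum_mul_le hr hRRx
  nlinarith [mul_le_mul_of_nonneg_left this (sq_nonneg γ)]

end LinearSystem

/-! ### Closed forms of the coefficients and dependence on the window. -/

section ClosedForms

/-- Passing from m to m + 1 adds a border of 2m + 1 entries, all equal to q^m. -/
lemma sum_sum_pow_max {q : ℝ} (hq : q ≠ 1) (m : ℕ) :
    ∑ i ∈ Finset.range m, ∑ j ∈ Finset.range m, q ^ max i j =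
      (1 - q ^ m) * (1 + q) / (1 - q) ^ 2 - 2 * m * q ^ m / (1 - q) := by
  have hq' : 1 - q ≠ 0 := sub_ne_zero.2 hq.symm
  induction m with
  | zero => simp
  | succ m ih =>
    have e1 : ∀ i ∈ Finset.range m, q ^ max i m = q ^ m := fun i hi => by
      rw [max_eq_right (Finset.mem_range.1 hi).le]
    have e2 : ∀ i ∈ Finset.range m, q ^ max m i = q ^ m := fun i hi => by
      rw [max_eq_left (Finset.mem_range.1 hi).le]
    simp only [Finset.sum_range_succ, Finset.sum_add_distrib]
    rw [ih, Finset.sum_congr rfl e1, Finset.sum_congr rfl e2]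
    simp only [Finset.sum_const, Finset.card_range, nsmul_eq_mul, max_self]
    field_simp
    push_cast
    ring

lemma lowSnrExpansion_eq_sum {ρ : ℝ} (hρ : ρ ^ 2 ≠ 1) (κ a : ℝ) (m : ℕ) (γ : ℝ) :
    lowSnrExpansion κ a ρ m γ = -(1 / 2) * Real.log
      (1 - Real.exp (-2 * κ * a) * (∑ i : Fin m, (ρ ^ 2) ^ (i : ℕ)) * γ
        + Real.exp (-2 * κ * a) * (∑ i : Fin m, ∑ j : Fin m, (ρ ^ 2) ^ max (i : ℕ) j) * γ ^ 2) := by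
  have h1 : ∑ i : Fin m, (ρ ^ 2) ^ (i : ℕ) = (1 - ρ ^ (2 * m)) / (1 - ρ ^ 2) := by
    rw [Fin.sum_univ_eq_sum_range (fun i => (ρ ^ 2) ^ i), geom_sum_eq hρ, pow_mul,
      ← neg_div_neg_eq, neg_sub, neg_sub]
  have h2 : ∑ i : Fin m, ∑ j : Fin m, (ρ ^ 2) ^ max (i : ℕ) j =
      (1 - ρ ^ (2 * m)) * (1 + ρ ^ 2) / (1 - ρ ^ 2) ^ 2
        - 2 * m * ρ ^ (2 * m) / (1 - ρ ^ 2) := by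
    rw [pow_mul, ← sum_sum_pow_max hρ, Finset.sum_congr rfl fun (i : Fin m) _ =>
      Fin.sum_univ_eq_sum_range (fun j => (ρ ^ 2) ^ max (i : ℕ) j) m,
      Fin.sum_univ_eq_sum_range (fun i => ∑ j ∈ Finset.range m, (ρ ^ 2) ^ max i j)]
  rw [lowSnrExpansion, h1, h2]
  ring_nf

lemma abs_log_sub_log_le {A B : ℝ} (hA : 1 / 2 ≤ A) (hB : 1 / 2 ≤ B) :
    |Real.log A - Real.log B| ≤ 2 * |A - B| := by
  have key : ∀ {A B : ℝ}, 1 / 2 ≤ A → 1 / 2 ≤ B → Real.log A - Real.log B ≤ 2 * |A - B| := by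
    intro A B hA hB
    have hB0 : 0 < B := by linarith
    rw [← Real.log_div (by linarith) hB0.ne']
    calc Real.log (A / B) ≤ A / B - 1 := Real.log_le_sub_one_of_pos (div_pos (by linarith) hB0)
      _ = (A - B) / B := by field_simp
      _ ≤ |A - B| / B := by gcongr; exact le_abs_self _
      _ ≤ 2 * |A - B| := by
        rw [div_le_iff₀ hB0]
        nlinarith [abs_nonneg (A - B)]
  rw [abs_sub_le_iff]
  exact ⟨key hA hB, abs_sub_comm A B ▸ key hB hA⟩

lemma hasDerivAt_lowSnrExpansion (κ a ρ : ℝ) (m : ℕ) :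
    HasDerivAt (lowSnrExpansion κ a ρ m)
      (1 / 2 * (Real.exp (-2 * κ * a) * (1 - ρ ^ (2 * m)) / (1 - ρ ^ 2))) 0 := by
  unfold lowSnrExpansion
  set b := Real.exp (-2 * κ * a) * (1 - ρ ^ (2 * m)) / (1 - ρ ^ 2)
  set c := Real.exp (-2 * κ * a) * ((1 - ρ ^ (2 * m)) * (1 + ρ ^ 2) / (1 - ρ ^ 2) ^ 2
            - 2 * m * ρ ^ (2 * m) / (1 - ρ ^ 2))
  have h := ((((hasDerivAt_id (0 : ℝ)).const_mul b).const_sub 1).add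
    (((hasDerivAt_id (0 : ℝ)).pow 2).const_mul c)).log (by simp)
  refine (h.const_mul (-(1 / 2))).congr_deriv ?_
  simp

open Filter Topology Asymptotics in
/-- The low-SNR expansions for different window lengths differ already at first order. -/
lemma not_isBigO_lowSnrExpansion_sub {ρ : ℝ} (hρ0 : 0 < ρ) (hρ1 : ρ < 1) (κ a : ℝ) {m m' : ℕ}
    (hmm : m' ≠ m) :
    ¬ (fun γ : ℝ => lowSnrExpansion κ a ρ m γ - lowSnrExpansion κ a ρ m' γ)
        =O[𝓝[>] 0] (fun γ : ℝ => γ ^ 3) := by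
  intro hO
  have hd := ((hasDerivAt_lowSnrExpansion κ a ρ m).sub
    (hasDerivAt_lowSnrExpansion κ a ρ m')).hasDerivWithinAt (s := Set.Ioi 0)
  -- Both expansions vanish at γ = 0, so an O(γ³) difference would have right derivative 0 there.
  have h0 : HasDerivWithinAt
      (lowSnrExpansion κ a ρ m - lowSnrExpansion κ a ρ m') 0 (Set.Ioi 0) 0 := by
    rw [hasDerivWithinAt_iff_isLittleO]
    have ho : (fun γ : ℝ => γ ^ 3) =o[𝓝[>] 0] (fun γ : ℝ => γ) := by
      have := (isLittleO_pow_pow (𝕜 := ℝ) (m := 1) (n := 3) (by norm_num)).mono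
        (nhdsWithin_le_nhds (s := Set.Ioi 0))
      simpa using this
    have := hO.trans_isLittleO ho
    simpa [lowSnrExpansion] using this
  have heq := (uniqueDiffWithinAt_Ioi (0 : ℝ)).eq_deriv _ hd h0
  have hsq : ρ ^ 2 < 1 := by nlinarith
  have hρ2 : 1 - ρ ^ 2 ≠ 0 := by linarith
  have : ρ ^ (2 * m) = ρ ^ (2 * m') := by
    have he := Real.exp_pos (-2 * κ * a)
    generalize Real.exp (-2 * κ * a) = b at he heq
    have h : b * (ρ ^ (2 * m') - ρ ^ (2 * m)) = 0 := by
      field_simp at heq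
      linarith
    linarith [(mul_eq_zero.1 h).resolve_left he.ne']
  have := pow_right_injective₀ hρ0 hρ1.ne this
  omega

end ClosedForms

/-! ### Observations and the exact value of information. -/

section ValueOfInformation

lemma exp_neg_mul_abs_sampleTime_sub (κ : ℝ) (Δt : ℝ≥0) (i j : ℕ) :
    Real.exp (-κ * |(sampleTime Δt i : ℝ) - sampleTime Δt j|) =
      Real.exp (-κ * Δt) ^ Nat.dist i j := by
  wlog h : i ≤ j generalizing i j
  · rw [abs_sub_comm, Nat.dist_comm]
    exact this j i (by omega)
  have h' : (i : ℝ) ≤ j := by exact_mod_cast h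
  rw [← Real.exp_nat_mul, Nat.dist_eq_sub_of_le h, Nat.cast_sub h, sampleTime, sampleTime]
  push_cast
  rw [abs_of_nonpos (by nlinarith [Δt.coe_nonneg])]
  ring_nf

lemma IsGaussianNoise.hasLaw {Ω : Type*} [MeasurableSpace Ω] {P : Measure Ω} {σn : ℝ}
    {X : ℝ≥0 → Ω → ℝ} {N : ℕ → Ω → ℝ} (hN : IsGaussianNoise σn X N P) (i : ℕ) :
    HasLaw (N i) (gaussianReal 0 (σn ^ 2).toNNReal) P :=
  ⟨(hN.measurable i).aemeasurable, hN.law i⟩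

variable {Ω : Type*} [MeasurableSpace Ω] {P : Measure Ω} [IsProbabilityMeasure P]
  {κ θ σ σn : ℝ} {X W : ℝ≥0 → Ω → ℝ} {N : ℕ → Ω → ℝ} {Δt t : ℝ≥0} {m n : ℕ}

/-- Joint law of the status at time `t` and the last `m` observations, centered at `θ`. -/
lemma hasGaussianLaw_status_observation (hκ : 0 < κ) (hX : IsStationaryOU κ θ σ X W P)
    (hN : IsGaussianNoise σn X N P) (hmn : m ≤ n) (ht : sampleTime Δt n ≤ t) :
    HasGaussianLaw (fun ω => (X t ω - θ,
        fun k : Fin m => observation Δt X N (n - k) ω - θ)) P ∧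
      Var[fun ω => X t ω - θ; P] = σ ^ 2 / (2 * κ) ∧
      (∀ k : Fin m, cov[fun ω => X t ω - θ, fun ω => observation Δt X N (n - k) ω - θ; P] =
        σ ^ 2 / (2 * κ) * (Real.exp (-κ * (t - sampleTime Δt n)) *
          Real.exp (-κ * Δt) ^ (k : ℕ))) ∧
      (∀ j k : Fin m, cov[fun ω => observation Δt X N (n - j) ω - θ,
          fun ω => observation Δt X N (n - k) ω - θ; P] =
        σ ^ 2 / (2 * κ) * Real.exp (-κ * Δt) ^ Nat.dist j k + if j = k then σn ^ 2 else 0) ∧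
      (P[fun ω => X t ω - θ] = 0 ∧
        ∀ k : Fin m, P[fun ω => observation Δt X N (n - k) ω - θ] = 0) := by
  let τ : Option (Fin m) → ℝ≥0 := fun o => o.elim t fun k => sampleTime Δt (n - k)
  obtain ⟨hG, hmean, hcov⟩ := hX.hasGaussianLaw hκ τ
  have hXm : ∀ o, MemLp (fun ω => X (τ o) ω - θ) 2 P := fun o => (hG.eval o).memLp_two
  have hNm : ∀ i, MemLp (N i) 2 P := fun i => (hN.hasLaw i).hasGaussianLaw.memLp_two
  -- Since k < m ≤ n, the subtraction n - k never truncates.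
  have hinj : Function.Injective fun k : Fin m => n - (k : ℕ) := fun j k h => by
    ext; have := j.2; have := k.2; simp only at h; omega
  have hGN : HasGaussianLaw (fun ω (k : Fin m) => N (n - k) ω) P :=
    (hN.indep.precomp hinj).hasGaussianLaw fun k => (hN.hasLaw _).hasGaussianLaw
  have hind : IndepFun (fun ω o => X (τ o) ω - θ) (fun ω (k : Fin m) => N (n - k) ω) P :=
    hN.indep_process.comp (φ := fun (x : ℝ≥0 → ℝ) o => x (τ o) - θ)
      (ψ := fun (y : ℕ → ℝ) (k : Fin m) => y (n - k)) (by fun_prop) (by fun_prop)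
  have hXN : ∀ o i, cov[fun ω => X (τ o) ω - θ, N i; P] = 0 := fun o i =>
    (hN.indep_process.comp (φ := fun x : ℝ≥0 → ℝ => x (τ o) - θ) (ψ := fun y : ℕ → ℝ => y i)
      (by fun_prop) (by fun_prop)).covariance_eq_zero (hXm o) (hNm i)
  have hNX : ∀ o i, cov[N i, fun ω => X (τ o) ω - θ; P] = 0 := fun o i => by
    rw [covariance_comm]; exact hXN o i
  have hNN : ∀ j k : Fin m, cov[N (n - j), N (n - k); P] = if j = k then σn ^ 2 else 0 := by
    intro j k
    split_ifs with h
    · rw [h, covariance_self (hN.measurable _).aemeasurable, (hN.hasLaw _).variance_eq,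
        variance_id_gaussianReal, Real.coe_toNNReal _ (sq_nonneg _)]
    · exact (hN.indep.indepFun (hinj.ne h)).covariance_eq_zero (hNm _) (hNm _)
  have hobs : ∀ k : Fin m, (fun ω => observation Δt X N (n - k) ω - θ) =
      (fun ω => X (τ (some k)) ω - θ) + N (n - k) := fun k => by
    funext ω
    simp only [observation, τ, Option.elim_some, Pi.add_apply]
    ring
  have hobs' : ∀ (k : Fin m) ω, observation Δt X N (n - k) ω - θ =
      (X (τ (some k)) ω - θ) + N (n - k) ω := fun k ω => congrFun (hobs k) ω
  refine ⟨?_, ?_, fun k => ?_, fun j k => ?_, hmean none, fun k => ?_⟩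
  · have h := (hind.hasGaussianLaw hG hGN).map_fun
      (((ContinuousLinearMap.proj (R := ℝ) (φ := fun _ : Option (Fin m) => ℝ) none).comp
        (ContinuousLinearMap.fst ℝ (Option (Fin m) → ℝ) (Fin m → ℝ))).prod
        (ContinuousLinearMap.pi fun k =>
          (ContinuousLinearMap.proj (R := ℝ) (φ := fun _ : Option (Fin m) => ℝ) (some k)).comp
            (ContinuousLinearMap.fst ℝ (Option (Fin m) → ℝ) (Fin m → ℝ)) +
          (ContinuousLinearMap.proj (R := ℝ) (φ := fun _ : Fin m => ℝ) k).comp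
            (ContinuousLinearMap.snd ℝ (Option (Fin m) → ℝ) (Fin m → ℝ))))
    refine h.congr (ae_of_all _ fun ω => Prod.ext rfl ?_)
    funext k
    exact (hobs' k ω).symm
  · have := hcov none none
    rw [covariance_self (hXm none).1.aemeasurable] at this
    simpa [τ] using this
  · rw [hobs]
    change cov[fun ω => X (τ none) ω - θ, _; P] = _
    rw [covariance_add_right (hXm none) (hXm _) (hNm _), hXN none]
    have h := hcov none (some k)
    rw [h, add_zero, ← Real.exp_nat_mul, ← Real.exp_add]
    have hk : (k : ℕ) ≤ n := k.2.le.trans hmn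
    have ht' : (n : ℝ) * Δt ≤ t := by exact_mod_cast ht
    have hk0 : (0 : ℝ) ≤ (k : ℕ) * Δt := by positivity
    have e : |(τ none : ℝ) - τ (some k)| = t - n * Δt + k * Δt := by
      simp only [τ, Option.elim_none, Option.elim_some, sampleTime, NNReal.coe_mul,
        NNReal.coe_natCast, Nat.cast_sub hk]
      rw [abs_of_nonneg (by linarith)]
      ring
    rw [e, sampleTime]
    push_cast
    ring_nf
  · rw [hobs, hobs, covariance_add_left (hXm _) (hNm _) ((hXm _).add (hNm _)),
      covariance_add_right (hXm _) (hXm _) (hNm _), covariance_add_right (hNm _) (hXm _) (hNm _),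
      hXN, hNX, hNN, hcov]
    simp only [τ, Option.elim_some, exp_neg_mul_abs_sampleTime_sub, add_zero, zero_add]
    have hj := j.2
    have hk := k.2
    have e : Nat.dist (n - j) (n - k) = Nat.dist j k := by simp only [Nat.dist]; omega
    rw [e]
  · simp only [hobs']
    rw [integral_add ((hXm _).integrable one_le_two) ((hNm _).integrable one_le_two),
      hmean (some k), (hN.hasLaw _).integral_eq, integral_id_gaussianReal, add_zero]

/-- The value of information in terms of a solution `x` of the normal equations. -/
theorem valueOfInformation_eq_log (hκ : 0 < κ) (hσ : 0 < σ) (hσn : 0 < σn)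
    (hX : IsStationaryOU κ θ σ X W P) (hN : IsGaussianNoise σn X N P) (hmn : m ≤ n)
    (ht : sampleTime Δt n ≤ t) {x : Fin m → ℝ}
    (hx : ∀ i, x i + snr κ σ σn * ∑ j : Fin m, Real.exp (-κ * Δt) ^ Nat.dist i j * x j =
      Real.exp (-κ * Δt) ^ (i : ℕ))
    (hpos : 0 < 1 - Real.exp (-2 * κ * (t - sampleTime Δt n)) * snr κ σ σn *
      ∑ i : Fin m, Real.exp (-κ * Δt) ^ (i : ℕ) * x i) :
    valueOfInformation X (observation Δt X N) m n t P ≠ ∞ ∧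
      (valueOfInformation X (observation Δt X N) m n t P).toReal =
        -(1 / 2) * Real.log (1 - Real.exp (-2 * κ * (t - sampleTime Δt n)) * snr κ σ σn *
          ∑ i : Fin m, Real.exp (-κ * Δt) ^ (i : ℕ) * x i) := by
  obtain ⟨hG, hvarU, hcU, hcV, hmU, hmV⟩ :=
    hasGaussianLaw_status_observation hκ hX hN hmn ht
  set ρ := Real.exp (-κ * Δt)
  set α := Real.exp (-κ * (t - sampleTime Δt n)) with hα
  set γ := snr κ σ σn with hγ
  have hα2 : Real.exp (-2 * κ * (t - sampleTime Δt n)) = α ^ 2 := by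
    rw [hα, ← Real.exp_nat_mul]; push_cast; ring_nf
  rw [hα2] at hpos ⊢
  set A := 1 - α ^ 2 * γ * ∑ i : Fin m, ρ ^ (i : ℕ) * x i with hA
  set s := σ ^ 2 / (2 * κ) with hs
  have hs0 : 0 < s := by positivity
  have hsγ : s = γ * σn ^ 2 := by rw [hs, hγ, snr]; field_simp
  set U : Ω → ℝ := fun ω => X t ω - θ with hU
  set V : Fin m → Ω → ℝ := fun k ω => observation Δt X N (n - k) ω - θ with hV
  -- The regression residual. Orthogonality to V means (sR + σn²)c = sα r for the coefficients c; as
  -- s = γσn², this gives c = αγx.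
  set E : Ω → ℝ := fun ω => U ω - ∑ k, (α * γ * x k) * V k ω with hE
  have hobs : ∀ i, Measurable (observation Δt X N i) := fun i =>
    (hX.measurable _).add (hN.measurable i)
  have hVmeas : ∀ k, Measurable (V k) := fun k => (hobs _).sub_const _
  have hUmeas : Measurable U := (hX.measurable t).sub_const _
  have hEmeas : Measurable E := by fun_prop
  have hUm : MemLp U 2 P := hG.fst.memLp_two
  have hVm : ∀ k, MemLp (V k) 2 P := fun k => (hG.snd.eval k).memLp_two
  have hSm : MemLp (fun ω => ∑ k, (α * γ * x k) * V k ω) 2 P :=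
    memLp_finsetSum _ fun k _ => (hVm k).const_mul _
  have hcVV : ∀ j k, cov[V j, V k; P] =
      s * ρ ^ Nat.dist j k + if j = k then σn ^ 2 else 0 := hcV
  have hcEV : ∀ j, cov[E, V j; P] = 0 := by
    intro j
    rw [hE, covariance_fun_sub_left hUm hSm (hVm j), hcU,
      covariance_fun_sum_left (fun k => (hVm k).const_mul _) (hVm j)]
    simp only [covariance_const_mul_left, hcVV, mul_add, Finset.sum_add_distrib, mul_ite, mul_zero,
      Finset.sum_ite_eq', Finset.mem_univ, if_true]
    have e : ∑ k : Fin m, α * γ * x k * (s * ρ ^ Nat.dist k j) =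
        α * γ * s * ∑ k : Fin m, ρ ^ Nat.dist j k * x k := by
      rw [Finset.mul_sum]
      refine Finset.sum_congr rfl fun k _ => ?_
      rw [Nat.dist_comm]; ring
    rw [e]
    linear_combination (-s * α) * hx j + (α * x j) * hsγ
  have hEV : HasGaussianLaw (fun ω => (fun _ : Unit => E ω, fun k => V k ω)) P := by
    have h := hG.map_fun ((ContinuousLinearMap.pi fun _ : Unit =>
        ContinuousLinearMap.fst ℝ ℝ (Fin m → ℝ) - ∑ k, (α * γ * x k) •
          (ContinuousLinearMap.proj (R := ℝ) (φ := fun _ : Fin m => ℝ) k).comp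
            (ContinuousLinearMap.snd ℝ ℝ (Fin m → ℝ))).prod
      (ContinuousLinearMap.snd ℝ ℝ (Fin m → ℝ)))
    refine h.congr (ae_of_all _ fun ω => Prod.ext ?_ rfl)
    funext _
    simp [hE, hU, hV]
  have hind : IndepFun E (fun ω k => observation Δt X N (n - (k : Fin m)) ω) P := by
    have h := hEV.indepFun_of_covariance_eval (X := fun _ : Unit => E) (Y := V) fun _ j => hcEV j
    have h1 : Measurable fun e : Unit → ℝ => e () := measurable_pi_apply ()
    have h2 : Measurable fun (v : Fin m → ℝ) k => v k + θ := by fun_prop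
    have h3 := h.comp h1 h2
    have e : (fun ω k => observation Δt X N (n - (k : Fin m)) ω) =
        (fun (v : Fin m → ℝ) k => v k + θ) ∘ fun ω k => V k ω := by
      funext ω k
      simp [hV]
    rw [e]
    exact h3
  have hEg : HasGaussianLaw E P := hEV.fst.eval ()
  have hmE : P[E] = 0 := by
    rw [hE, integral_sub (hUm.integrable one_le_two) (hSm.integrable one_le_two), hmU,
      integral_finsetSum _ fun k _ => ((hVm k).integrable one_le_two).const_mul _]
    simp [integral_const_mul, hV, hmV]
  have hvE : Var[E; P] = s * A := by
    have hcUV : ∀ k, cov[V k, U; P] = s * (α * ρ ^ (k : ℕ)) := fun k => by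
      rw [covariance_comm]; exact hcU k
    -- E is orthogonal to its own regressor, so Var E = cov(E, U).
    have h1 : cov[E, fun ω => ∑ k, (α * γ * x k) * V k ω; P] = 0 := by
      rw [covariance_fun_sum_right (fun k => (hVm k).const_mul _) hEg.memLp_two]
      simp [covariance_const_mul_right, hcEV]
    rw [← covariance_self hEmeas.aemeasurable]
    conv_lhs => arg 2; rw [hE]
    rw [covariance_fun_sub_right hEg.memLp_two hUm hSm, h1, sub_zero]
    conv_lhs => arg 1; rw [hE]
    rw [covariance_fun_sub_left hUm hSm hUm, covariance_self hUmeas.aemeasurable, hvarU,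
      covariance_fun_sum_left (fun k => (hVm k).const_mul _) hUm]
    simp only [covariance_const_mul_left, hcUV, hA, mul_sub, mul_one, Finset.mul_sum]
    congr 1
    refine Finset.sum_congr rfl fun k _ => by ring
  have hlE : P.map E = gaussianReal 0 (s * A).toNNReal := by
    rw [hEg.map_eq_gaussianReal, hmE, hvE]
  have hdecomp : (fun ω => E ω + (θ + ∑ k : Fin m, (α * γ * x k) *
      (observation Δt X N (n - k) ω - θ))) = X t := by
    funext ω
    simp only [hE, hU, hV]
    ring
  have hlU : P.map (X t) = gaussianReal θ s.toNNReal := by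
    have h : HasLaw U (gaussianReal 0 s.toNNReal) P :=
      ⟨hUmeas.aemeasurable, by rw [hG.fst.map_eq_gaussianReal, hmU, hvarU]⟩
    have h2 := (gaussianReal_add_const h θ).map_eq
    simpa [hU] using h2
  have hfin := mutualInfo_add_of_indepFun (P := P) hEmeas
    (V := fun ω (k : Fin m) => observation Δt X N (n - k) ω) (by fun_prop)
    (g := fun v => θ + ∑ k : Fin m, (α * γ * x k) * (v k - θ)) (by fun_prop)
    (v₁ := (s * A).toNNReal) (v₂ := s.toNNReal) (Real.toNNReal_pos.2 (by positivity)).ne'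
    (Real.toNNReal_pos.2 hs0).ne' hind hlE (by rw [hdecomp]; exact hlU)
  rw [hdecomp] at hfin
  refine ⟨hfin.1, hfin.2.trans ?_⟩
  rw [Real.coe_toNNReal _ hs0.le, Real.coe_toNNReal _ (by positivity),
    show s / (s * A) = A⁻¹ by field_simp, Real.log_inv]
  ring

end ValueOfInformation

/-! ### The low-SNR expansion. -/

theorem corollary3 (κ : ℝ) (hκ : 0 < κ) (Δt : ℝ≥0) (hΔt : 0 < Δt)
    (m n : ℕ) (hm : 1 ≤ m) (hmn : m ≤ n)
    (t' : ℕ → ℝ≥0) (ht' : ∀ i, 1 ≤ i → i ≤ n → sampleTime Δt i < t' i)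
    (t : ℝ≥0) (ht : t' n < t) :
    (∃ C δ : ℝ, 0 < δ ∧
      ∀ θ σ σn : ℝ, 0 < σ → 0 < σn → snr κ σ σn < δ →
      ∀ (Ω : Type*) [MeasurableSpace Ω] (P : Measure Ω) [IsProbabilityMeasure P]
        (X W : ℝ≥0 → Ω → ℝ) (N : ℕ → Ω → ℝ),
        IsStationaryOU κ θ σ X W P → IsGaussianNoise σn X N P →
        valueOfInformation X (observation Δt X N) m n t P ≠ ∞ ∧
        |(valueOfInformation X (observation Δt X N) m n t P).toReal
            - lowSnrExpansion κ ((t : ℝ) - (sampleTime Δt n : ℝ)) (Real.exp (-κ * (Δt : ℝ))) m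
                (snr κ σ σn)|
          ≤ C * snr κ σ σn ^ 3) ∧
    (∀ m' : ℕ, 1 ≤ m' → m' ≠ m →
      ¬ (fun γ : ℝ =>
          lowSnrExpansion κ ((t : ℝ) - (sampleTime Δt n : ℝ)) (Real.exp (-κ * (Δt : ℝ))) m γ
          - lowSnrExpansion κ ((t : ℝ) - (sampleTime Δt n : ℝ)) (Real.exp (-κ * (Δt : ℝ))) m' γ)
        =O[nhdsWithin 0 (Set.Ioi 0)] (fun γ : ℝ => γ ^ 3)) := by
  have htn : sampleTime Δt n < t := (ht' n (hm.trans hmn) le_rfl).trans ht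
  have hΔ : (0 : ℝ) < Δt := hΔt
  have hρ0 : 0 < Real.exp (-κ * (Δt : ℝ)) := Real.exp_pos _
  have hρ1 : Real.exp (-κ * (Δt : ℝ)) < 1 := by
    rw [Real.exp_lt_one_iff]; nlinarith
  -- With γm < 1/4, the bounds aγ|r·x| ≤ 2mγ and aSγ ≤ mγ keep both logarithm arguments above 1/2.
  -- The constant is the prefactor 1/2 times the Lipschitz constant 2 times the quadratic-form error
  -- 2m³.
  refine ⟨⟨2 * m ^ 3, 1 / (4 * m), by positivity, ?_⟩, fun m' _ hmm =>
    not_isBigO_lowSnrExpansion_sub hρ0 hρ1 κ _ hmm⟩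
  intro θ σ σn hσ hσn hδ Ω _ P _ X W N hX hN
  have hm0 : (0 : ℝ) < m := by exact_mod_cast hm
  have hγ0 : 0 < snr κ σ σn := by rw [snr]; positivity
  have hq1 : Real.exp (-κ * (Δt : ℝ)) ^ 2 ≠ 1 := by nlinarith
  have hα1 : Real.exp (-2 * κ * ((t : ℝ) - sampleTime Δt n)) ≤ 1 := by
    have : (sampleTime Δt n : ℝ) < t := htn
    rw [Real.exp_le_one_iff]; nlinarith
  have hα0 := Real.exp_pos (-2 * κ * ((t : ℝ) - sampleTime Δt n))
  set γ := snr κ σ σn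
  set ρ := Real.exp (-κ * (Δt : ℝ))
  set a := Real.exp (-2 * κ * ((t : ℝ) - sampleTime Δt n))
  have hγm4 : γ * m < 1 / 4 := by
    rw [lt_div_iff₀ (by positivity)] at hδ
    linarith
  have hpow : ∀ i : ℕ, |ρ ^ i| ≤ 1 := fun i => by
    rw [abs_of_nonneg (by positivity)]; exact pow_le_one₀ hρ0.le hρ1.le
  obtain ⟨x, hx⟩ := exists_add_smul_eq (R := fun i j : Fin m => ρ ^ Nat.dist i j)
    (fun i j => hpow _) hγ0.le (by linarith) (fun i : Fin m => ρ ^ (i : ℕ))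
  obtain ⟨hb1, hb2⟩ := abs_dotProduct_sub_le (R := fun i j : Fin m => ρ ^ Nat.dist i j)
    (r := fun i : Fin m => ρ ^ (i : ℕ)) (fun i j => hpow _) (fun i => hpow _) hγ0.le (by linarith) hx
  have hS : ∑ i : Fin m, ρ ^ (i : ℕ) * ρ ^ (i : ℕ) = ∑ i : Fin m, (ρ ^ 2) ^ (i : ℕ) :=
    Finset.sum_congr rfl fun i _ => by rw [← pow_add, ← pow_mul, two_mul]
  have hQ : ∑ i : Fin m, ∑ j : Fin m, ρ ^ (i : ℕ) * ρ ^ Nat.dist i j * ρ ^ (j : ℕ) =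
      ∑ i : Fin m, ∑ j : Fin m, (ρ ^ 2) ^ max (i : ℕ) j :=
    Finset.sum_congr rfl fun i _ => Finset.sum_congr rfl fun j _ => by
      rw [← pow_add, ← pow_add, ← pow_mul]
      congr 1
      simp only [Nat.dist]
      omega
  rw [hS, hQ] at hb2
  rw [lowSnrExpansion_eq_sum hq1]
  set S := ∑ i : Fin m, (ρ ^ 2) ^ (i : ℕ) with hSdef
  set Q := ∑ i : Fin m, ∑ j : Fin m, (ρ ^ 2) ^ max (i : ℕ) j
  set p := ∑ i : Fin m, ρ ^ (i : ℕ) * x i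
  have hQ0 : 0 ≤ Q := Finset.sum_nonneg fun i _ => Finset.sum_nonneg fun j _ => by positivity
  have hS0 : 0 ≤ S := Finset.sum_nonneg fun i _ => by positivity
  have hSm : S ≤ m := by
    calc S ≤ ∑ _i : Fin m, (1 : ℝ) := Finset.sum_le_sum fun i _ => by
          rw [← pow_mul]; exact pow_le_one₀ hρ0.le hρ1.le
      _ = m := by simp
  have hA : 1 / 2 ≤ 1 - a * γ * p := by
    have h1 : |a * γ * p| ≤ 1 * γ * (2 * m) := by
      rw [abs_mul, abs_mul, abs_of_pos hα0, abs_of_pos hγ0]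
      gcongr
    linarith [le_abs_self (a * γ * p)]
  have hB : 1 / 2 ≤ 1 - a * S * γ + a * Q * γ ^ 2 := by
    have h1 : a * S * γ ≤ 1 * m * γ := by gcongr
    have h2 : 0 ≤ a * Q * γ ^ 2 := by positivity
    linarith
  obtain ⟨hfin, hval⟩ := valueOfInformation_eq_log hκ hσ hσn hX hN hmn htn.le hx (by linarith)
  refine ⟨hfin, ?_⟩
  rw [hval, ← mul_sub, abs_mul]
  have hlog := abs_log_sub_log_le hA hB
  -- The factor γ in front of r·x raises its γ² error to γ³.
  have hdiff : |1 - a * γ * p - (1 - a * S * γ + a * Q * γ ^ 2)| ≤ 2 * m ^ 3 * γ ^ 3 := by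
    have e : 1 - a * γ * p - (1 - a * S * γ + a * Q * γ ^ 2) = -(a * γ * (p - (S - γ * Q))) := by
      ring
    rw [e, abs_neg, abs_mul, abs_mul, abs_of_pos hα0, abs_of_pos hγ0]
    calc a * γ * |p - (S - γ * Q)| ≤ 1 * γ * (2 * m ^ 3 * γ ^ 2) := by gcongr
      _ = _ := by ring
  have h12 : |(-(1 / 2) : ℝ)| = 1 / 2 := by norm_num
  rw [h12]
  linarith
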